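/- \textbf{Quandle.} Let $R_3=\mathbb Z/3$ and $\mathbb Z_2=\{0,1\}$. The operations $a\triangleleft_0 b=a$ and $a\triangleleft_1 b=2b-a$ make $R_3$ a $\mathbb Z_2$-family of quandles. Its associated quandle $\tilde R=R_3\times\mathbb Z_2$ has the operation $(a,g)\triangleleft(b,h)=(a\triangleleft_h b,g)$. Let $\theta_3(a,b,c)=(a-b)(c^3+c^2b+b^2c)\in\mathbb Z_3$ (Mochizuki's $3$-cocycle of $R_3$), and define $\theta\colon\tilde R^3\to\mathbb Z_3$ by $\theta((x_1,g_1),(x_2,g_2),(x_3,g_3))=\theta_3(x_1,x_2,x_3)$ if $g_1=g_2=g_3=1$, and $\theta=0$ otherwise. \textbf{Foam.} Let $\Gamma\subset\mathbb R^3$ be the following knotted $\theta$-graph, which represents the handlebody-knot $5_2$. It consists of a trefoil and an arc $N$ that joins two points of the trefoil. In a diagram with five crossings the trefoil has its standard three crossings; the six diagram edges of the trefoil are three inner and three outer ones; $N$ starts on one outer edge, hooks (clasps) the second outer edge by passing once over and once under it, and ends on the third outer edge, in such a way that each of the two other cycles of $\Gamma$ is unknotted. Cut $\Gamma$ at an interior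 point of one of the two edges that form the trefoil. Let $F$ be the $2$-twist-spin of the resulting knotted graph with two ends, where the circle swept by each end is collapsed to a point of the axis, so that the two pieces of the cut edge sweep two disks. This $F$ is a closed knotted $2$-foam in $\mathbb R^4$. It is presented by the diagram in $\mathbb R^3$ in which each full twist moves the cut graph through a kink: once over and once under the crossing of the kink. \textbf{Colorings.} A coloring of $F$ assigns an element of $\tilde R$ to each sheet of the diagram of $F$ and a transverse orientation to each face of $F$, with the following properties. The two disks that come from the cut edge carry the transverse orientations that are induced by one orientation of this edge, so the transverse orientations of the faces correspond to the orientations of the three edges of $\Gamma$. At a double curve with over-sheet colored $q$, the color of the under-sheet changes from $p$ to $p\triangleleft q$ in the direction of the normal of the over-sheet. Where three sheets meet at an edge of $F$, their first components agree, and either all the second components are $0$, or exactly one is $0$ and the transverse orientations of the two other sheets are consistent. \textbf{Invariant.} The value of a coloring is the sum over all triple points of $\pm\theta(p,q,r)$. Here $p,q,r$ are the colors of the bottom, middle and top sheets next to the region from which all the normals point away. The sign is $+$ if the normals of the top, middle and bottom sheets, in this order, form a right-handed frame, and $-$ otherwise. (The cocycles at all the other $0$-dimensional multiple points are taken to be $0$.)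 The quandle cocycle invariant of $F$ is the multiset of the values of all the colorings, written as a polynomial in $t$ in which $t^v$ stands for the value $v\in\mathbb Z_3$. \textbf{Theorem.} For either choice of the edge at which $\Gamma$ is cut, the quandle cocycle invariant of $F$ is $60+12t+12t^2$. That is, the value $0$ occurs $60$ times and the values $1$ and $2$ occur $12$ times each. In particular the invariant is non-trivial: some coloring has a non-zero value. -/

import Mathlib

/-! ## Group families of quandles, the quandle `R̃`, and the cocycle `θ` -/

namespace KnottedFoam

/-- A `G`-family of quandles on `X`; `op g a b` is `a ◁_g b`. -/
structure GFamily (G X : Type*) [Group G] where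
  op : G → X → X → X
  idem : ∀ g a, op g a a = a
  comp : ∀ g h a b, op h (op g a b) b = op (g * h) a b
  one : ∀ a b, op 1 a b = a
  distrib : ∀ g h a b c, op h (op g a b) c = op (h⁻¹ * g * h) (op h a c) (op h b c)

/-- The operation `(a, g) ◁ (b, h) = (a ◁_h b, h⁻¹ g h)` of the associated quandle on `X × G`. -/
def GFamily.assoc {G X : Type*} [Group G] (Q : GFamily G X) (p q : X × G) : X × G :=
  (Q.op q.2 p.1 q.1, q.2⁻¹ * p.2 * q.2)

/-- The group `ℤ₂ = {0, 1}`, written multiplicatively in Lean: its identity is the `0` of `ℤ₂`,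
and `Z2.one` is the `1` of `ℤ₂`. -/
abbrev Z2 : Type := Multiplicative (ZMod 2)

/-- The non-identity element of `ℤ₂`. -/
def Z2.one : Z2 := Multiplicative.ofAdd 1

/-- The `ℤ₂`-family of quandles on `R₃ = ℤ/3`: `a ◁_0 b = a` and `a ◁_1 b = 2b - a`. -/
def dihedralFamily : GFamily Z2 (ZMod 3) where
  op g a b := if g = 1 then a else 2 * b - a
  idem := by decide
  comp := by decide
  one := by decide
  distrib := by decide

/-- The underlying set `R₃ × ℤ₂` of the associated quandle `R̃`. -/
abbrev RTilde : Type := ZMod 3 × Z2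

/-- The quandle operation of `R̃`. -/
def RTilde.op (p q : RTilde) : RTilde := dihedralFamily.assoc p q

/-- Mochizuki's 3-cocycle of `R₃`, in simplified form. -/
def theta3 (a b c : ZMod 3) : ZMod 3 := (a - b) * (c ^ 3 + c ^ 2 * b + b ^ 2 * c)

/-- The cocycle `θ` of `R̃`. -/
def theta (p q r : RTilde) : ZMod 3 :=
  if p.2 = Z2.one ∧ q.2 = Z2.one ∧ r.2 = Z2.one then theta3 p.1 q.1 r.1 else 0

/-! ## Diagrams of knotted trivalent graphs

A diagram is cut into horizontal layers, read from bottom to top.  In each layer there is exactly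
one elementary piece; all the other strands go straight up. -/

/-- The elementary pieces: a minimum, a maximum, a crossing, and the two shapes of a trivalent
vertex (one strand below and two above, or two below and one above).
In `cross o` the two strands are exchanged; the strand that starts on the left (and ends on the
right) is the over-strand if `o = true` and the under-strand if `o = false`. -/
inductive Kind : Type
  | cup | cap | cross (o : Bool) | split | merge
  deriving DecidableEq

/-- Number of strands at the bottom of an elementary piece. -/
def Kind.inn : Kind → ℕ
  | .cup => 0 | .cap => 2 | .cross _ => 2 | .split => 1 | .merge => 2

/-- Number of strands at the top of an elementary piece. -/
def Kind.out : Kind → ℕ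
  | .cup => 2 | .cap => 0 | .cross _ => 2 | .split => 2 | .merge => 1

/-- The elementary piece after a rotation of the plane by the angle `π`. -/
def Kind.rot : Kind → Kind
  | .cup => .cap | .cap => .cup | .cross o => .cross o | .split => .merge | .merge => .split

/-- A layer: an elementary piece with `pos` straight strands on its left. -/
structure Gen : Type where
  kind : Kind
  pos : ℕ
  deriving DecidableEq

def cup (i : ℕ) : Gen := ⟨.cup, i⟩
def cap (i : ℕ) : Gen := ⟨.cap, i⟩
def cross (o : Bool) (i : ℕ) : Gen := ⟨.cross o, i⟩
def split (i : ℕ) : Gen := ⟨.split, i⟩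
def merge (i : ℕ) : Gen := ⟨.merge, i⟩

/-- A diagram of a trivalent graph with ends (a trivalent tangle), as a list of layers. -/
abbrev Diagram : Type := List Gen

/-- The number of strands above a diagram that has `n` strands below it, if the layers fit. -/
def topWidth : ℕ → Diagram → Option ℕ
  | n, [] => some n
  | n, g :: w => if g.pos + g.kind.inn ≤ n then topWidth (n - g.kind.inn + g.kind.out) w else none

/-! ## Moves between diagrams

The local changes that two consecutive stills of a movie of a foam can show. -/

/-- The strand in position `i + k` travels from right to left across `k` strands. -/
def leftward (o : Bool) (i k : ℕ) : Diagram := (List.range k).reverse.map fun t => cross o (i + t)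

/-- The strand in position `i` travels from left to right across `k` strands. -/
def rightward (o : Bool) (i k : ℕ) : Diagram := (List.range k).map fun t => cross o (i + t)

/-- Nested maxima that join `k` strands, starting at position `i`, to the next `k` strands. -/
def caps (i k : ℕ) : Diagram := (List.range k).reverse.map fun t => cap (i + t)

/-- Nested minima whose `2 k` upper ends start at position `i`. -/
def cups (i k : ℕ) : Diagram := (List.range k).map fun t => cup (i + t)

/-- The elementary moves.

* `far`, `zigzag`, `turnCap`, `turnCup`, `bend`: isotopies of the plane (two distant pieces
  exchange their heights; a zigzag is straightened; a piece is pushed over a maximum or under a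
  minimum and is turned by the angle `π`; one leg of a vertex is turned downwards).
* `r1`, `r2`, `r3`: Reidemeister moves.  In `r3 ab ac bc i` the three strands that start in
  positions `i`, `i + 1`, `i + 2` are called `a`, `b`, `c`, and `ab` tells whether `a` is over `b`,
  and so on.
* `slideL`, `slideR`: a strand passes over or under a minimum, a maximum or a vertex.
* `twistSplit`, `twistMerge`: two legs of a vertex are twisted.
* `assoc`: the move that creates a vertex of the foam.
* `birth`, `saddle`: critical points of the faces of the foam; `bubble`, `zip`: critical points of
  the edges of the foam. -/
inductive Move : Type
  | far (g h : Gen)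
  | zigzag (left : Bool) (i : ℕ)
  | turnCap (g : Gen)
  | turnCup (g : Gen)
  | bend (left : Bool) (i : ℕ)
  | r1 (left : Bool) (o : Bool) (i : ℕ)
  | r2 (o : Bool) (i : ℕ)
  | r3 (ab ac bc : Bool) (i : ℕ)
  | slideL (o : Bool) (g : Gen)
  | slideR (o : Bool) (g : Gen)
  | twistSplit (o : Bool) (i : ℕ)
  | twistMerge (o : Bool) (i : ℕ)
  | assoc (left : Bool) (i : ℕ)
  | birth (i : ℕ)
  | saddle (i : ℕ)
  | bubble (i : ℕ)
  | zip (i : ℕ)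

/-- The two local diagrams of a move.  In `far g h` the piece `g` lies to the left of `h`. -/
def Move.sides : Move → Diagram × Diagram
  | .far g h => ([g, h], [⟨h.kind, h.pos - g.kind.out + g.kind.inn⟩, g])
  | .zigzag true i => ([cup (i + 1), cap i], [])
  | .zigzag false i => ([cup i, cap (i + 1)], [])
  | .turnCap g => (g :: caps g.pos g.kind.out,
      ⟨g.kind.rot, g.pos + g.kind.inn⟩ :: caps g.pos g.kind.inn)
  | .turnCup g => (cups g.pos g.kind.out ++ [⟨g.kind.rot, g.pos + g.kind.out⟩],
      cups g.pos g.kind.inn ++ [g])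
  | .bend true i => ([split (i + 1), cap i], [merge i])
  | .bend false i => ([split i, cap (i + 1)], [merge i])
  | .r1 true o i => ([cup i, cross o (i + 1), cap i], [])
  | .r1 false o i => ([cup (i + 1), cross o i, cap (i + 1)], [])
  | .r2 o i => ([cross o i, cross (!o) i], [])
  | .r3 ab ac bc i => ([cross ab i, cross ac (i + 1), cross bc i],
      [cross bc (i + 1), cross ac i, cross ab (i + 1)])
  | .slideL o g => (g :: leftward o g.pos g.kind.out,
      leftward o g.pos g.kind.inn ++ [⟨g.kind, g.pos + 1⟩])
  | .slideR o g => (⟨g.kind, g.pos + 1⟩ :: rightward o g.pos g.kind.out,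
      rightward o g.pos g.kind.inn ++ [g])
  | .twistSplit o i => ([split i, cross o i], [split i])
  | .twistMerge o i => ([cross o i, merge i], [merge i])
  | .assoc true i => ([merge i, split i], [split (i + 1), merge i])
  | .assoc false i => ([merge i, split i], [split i, merge (i + 1)])
  | .birth i => ([], [cup i, cap i])
  | .saddle i => ([cap i, cup i], [])
  | .bubble i => ([], [split i, merge i])
  | .zip i => ([merge i, split i], [])

/-- The side conditions of the moves: the pieces of `far` are apart, the three strands of `r3` can
be put at three heights, and the `slide` moves are used for minima, maxima and vertices only. -/
def Move.valid : Move → Bool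
  | .far g h => decide (g.pos + g.kind.out ≤ h.pos)
  | .r3 ab ac bc _ => !(ab == bc && ab != ac)
  | .slideL _ g | .slideR _ g =>
    match g.kind with
    | .cross _ => false
    | _ => true
  | _ => true

/-- A step of a movie: a move, applied forwards (from the first to the second local diagram) or
backwards, above the lowest `start` layers of a still. -/
structure Step : Type where
  start : ℕ
  move : Move
  fwd : Bool

/-- The local diagram before the step. -/
def Step.src (s : Step) : Diagram := if s.fwd then s.move.sides.1 else s.move.sides.2

/-- The local diagram after the step. -/
def Step.tgt (s : Step) : Diagram := if s.fwd then s.move.sides.2 else s.move.sides.1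

/-- The next still, if the step can be applied. -/
def Step.apply (s : Step) (w : Diagram) : Option Diagram :=
  if s.move.valid = true ∧ s.start ≤ w.length ∧ (w.drop s.start).take s.src.length = s.src then
    some (w.take s.start ++ s.tgt ++ w.drop (s.start + s.src.length))
  else none

/-- Runs a movie; the result is `none` unless every step can be applied and every still is a
diagram with one end below and one end above. -/
def run : Diagram → List Step → Option Diagram
  | w, [] => if topWidth 1 w = some 1 then some w else none
  | w, s :: ss => if topWidth 1 w = some 1 then (s.apply w).bind fun v => run v ss else none

theorem run_append {w v : Diagram} {a b : List Step} (h : run w a = some v) :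
    run w (a ++ b) = run v b := by
  induction a generalizing w with
  | nil =>
    simp only [run] at h
    split at h
    · simp_all
    · simp at h
  | cons s a ih =>
    simp only [run, List.cons_append] at h ⊢
    split at h
    · rename_i hw
      rw [if_pos hw]
      cases hs : s.apply w with
      | none => simp [hs] at h
      | some u =>
        simp only [hs, Option.bind_some] at h ⊢
        exact ih h
    · simp at h

theorem run_replicate {w : Diagram} {a : List Step} (h : run w a = some w) (r : ℕ) :
    run w (List.replicate r a).flatten = some w := by
  induction r with
  | zero =>
    have hw : topWidth 1 w = some 1 := by
      by_contra hw
      cases a <;> simp [run, hw] at h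
    simp [run, hw]
  | succ r ih =>
    rw [List.replicate_succ, List.flatten_cons, run_append h, ih]

/-! ## Closed knotted foams

`ℝ⁴` is the union of the half-spaces `ℝ³₊` that are parametrized by an angle and have a plane as
their common boundary; the projection to `ℝ³` makes them half-planes (pages) around an axis.  A
closed foam in `ℝ⁴` that meets the plane transversely in two points appears as a closed movie: the
stills are diagrams of trivalent graphs in the page, with two ends on the axis.  The union of
the pages is a diagram (broken surface diagram) of the foam in `ℝ³`.  Each of the two ends sweeps
a disk. -/

/-- A diagram of a closed foam, as a movie that returns to its first still. -/
structure Foam : Type where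
  still : Diagram
  steps : List Step
  closed : run still steps = some still

/-! ### Colorings -/

/-- What a coloring says about a strand: the color in `R̃` of the sheet that it sweeps, and the
transverse orientation of this sheet.  The strand is oriented (`up = true`: upwards) such that
the normal of the sheet points to the right of the strand. -/
structure Label : Type where
  color : RTilde
  up : Bool
  deriving DecidableEq

instance : Inhabited Label := ⟨⟨(0, 1), true⟩⟩

/-- The condition at an edge of the foam where the sheets labelled `x`, `y`, `z` meet; `x'`, `y'`,
`z'` tell whether the orientation of the strand points to the vertex of the still.  The elements of
`R₃` agree, and either all the elements of `ℤ₂` are `0`, or exactly one is `0` and the orientations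
of the other two sheets are consistent. -/
def EdgeRule (x y z : RTilde) (x' y' z' : Bool) : Prop :=
  x.1 = y.1 ∧ y.1 = z.1 ∧
    ((x.2 = 1 ∧ y.2 = 1 ∧ z.2 = 1) ∨
      (x.2 = 1 ∧ y.2 = Z2.one ∧ z.2 = Z2.one ∧ y' ≠ z') ∨
      (y.2 = 1 ∧ x.2 = Z2.one ∧ z.2 = Z2.one ∧ x' ≠ z') ∨
      (z.2 = 1 ∧ x.2 = Z2.one ∧ y.2 = Z2.one ∧ x' ≠ y'))

/-- The condition at a crossing where the under-strand has color `u` on the left and `v` on the right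
of the over-strand `t`: if the normal of the over-sheet points from the side where the under-sheet
has color `p` to the side where it has color `q`, then `q = p ◁ t`. -/
def CrossRule (t : Label) (u v : RTilde) : Prop :=
  if t.up then v = u.op t.color else u = v.op t.color

/-- The conditions at an elementary piece, for the strands below and above it. -/
def Kind.Rule : Kind → List Label → List Label → Prop
  | .cup, [], [x, y] => x.color = y.color ∧ x.up ≠ y.up
  | .cap, [x, y], [] => x.color = y.color ∧ x.up ≠ y.up
  | .cross true, [x, y], [y', x'] => x' = x ∧ y'.up = y.up ∧ CrossRule x y'.color y.color
  | .cross false, [x, y], [y', x'] => y' = y ∧ x'.up = x.up ∧ CrossRule y x.color x'.color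
  | .split, [z], [x, y] => EdgeRule x.color y.color z.color (!x.up) (!y.up) z.up
  | .merge, [x, y], [z] => EdgeRule x.color y.color z.color x.up y.up (!z.up)
  | _, _, _ => False

/-- The conditions at a layer, for the strands below and above it. -/
def Gen.Rule (g : Gen) (l l' : List Label) : Prop :=
  ∃ A B x x', A.length = g.pos ∧ l = A ++ x ++ B ∧ l' = A ++ x' ++ B ∧ g.kind.Rule x x'

/-- `c` is a coloring of the diagram `w`: it lists the labels of the strands, from left to right,
below the first layer, then above the first layer, and so on. -/
def Diagram.IsColoring : Diagram → List (List Label) → Prop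
  | [], [_] => True
  | g :: w, l :: l' :: c => g.Rule l l' ∧ Diagram.IsColoring w (l' :: c)
  | _, _ => False

/-- The colorings of two consecutive stills agree outside the place where the stills differ. -/
def Step.Agree (s : Step) (c c' : List (List Label)) : Prop :=
  c.take (s.start + 1) = c'.take (s.start + 1) ∧
    c.drop (s.start + s.src.length) = c'.drop (s.start + s.tgt.length)

/-- `C` lists a coloring of each still of a movie, and consecutive colorings fit together. -/
def IsMovieColoring : Diagram → List Step → List (List (List Label)) → Prop
  | w, [], [c] => Diagram.IsColoring w c
  | w, s :: ss, c :: c' :: C => Diagram.IsColoring w c ∧ s.Agree c c' ∧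
      ∃ v, s.apply w = some v ∧ IsMovieColoring v ss (c' :: C)
  | _, _, _ => False

/-- The label of the strand in position `i` above the lowest `n` layers. -/
def labelAt (c : List (List Label)) (n i : ℕ) : Label := (c.getD n []).getD i default

/-- A coloring of the foam: a coloring of the movie that is the same on the first and on the last
still (the stills have one strand at the bottom).  The two ends of the stills are the two ends of
one edge of a trivalent graph that was cut open, and the transverse orientations of the two disks
that they sweep are those that come from an orientation of this edge. -/
def Foam.Coloring (F : Foam) : Type :=
  {C : List (List (List Label)) // IsMovieColoring F.still F.steps C ∧ C.head? = C.getLast? ∧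
    ∀ c ∈ C.head?, (c.getD 0 []).length = 1 ∧
      (labelAt c 0 0).up = (labelAt c F.still.length 0).up}

/-! ### Values -/

/-- The strands of `r3 ab ac bc i`, as `a = 0`, `b = 1`, `c = 2`, sorted: top, middle, bottom. -/
def r3Order : Bool → Bool → Bool → Fin 3 × Fin 3 × Fin 3
  | true, true, true => (0, 1, 2)
  | true, true, false => (0, 2, 1)
  | false, true, true => (1, 0, 2)
  | false, false, true => (1, 2, 0)
  | true, false, false => (2, 0, 1)
  | _, _, _ => (2, 1, 0)

/-- The sign of an order of `0, 1, 2`. -/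
def orderSign : Fin 3 × Fin 3 × Fin 3 → ZMod 3
  | (0, 1, 2) | (1, 2, 0) | (2, 0, 1) => 1
  | _ => -1

/-- The label of a piece of one of the three strands near a triple point.  The colorings `c`, `c'`
belong to the stills with the first and with the second local diagram of `r3`, the local diagrams
begin above the lowest `n` layers.  The first (second) truth value tells whether the piece lies above
the crossing with the smaller (larger) one of the other two strands. -/
def r3Label (c c' : List (List Label)) (n i : ℕ) : Fin 3 → Bool → Bool → Label
  | 0, false, false => labelAt c n i
  | 0, true, false => labelAt c (n + 1) (i + 1)
  | 0, false, true => labelAt c' (n + 2) (i + 1)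
  | 0, true, true => labelAt c (n + 3) (i + 2)
  | 1, false, false => labelAt c n (i + 1)
  | 1, true, false => labelAt c (n + 1) i
  | 1, false, true => labelAt c' (n + 1) (i + 2)
  | 1, true, true => labelAt c (n + 3) (i + 1)
  | 2, false, false => labelAt c n (i + 2)
  | 2, true, false => labelAt c (n + 2) (i + 1)
  | 2, false, true => labelAt c' (n + 1) (i + 1)
  | 2, true, true => labelAt c (n + 3) i

/-- The label of strand `s` in the region into which the normals of both other strands do not
point; `up` gives the orientations of the three strands. -/
def r3Source (c c' : List (List Label)) (n i : ℕ) (up : Fin 3 → Bool) (s : Fin 3) : Label :=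
  let above (u : Fin 3) : Bool := decide (s < u) != up u
  match s with
  | 0 => r3Label c c' n i 0 (above 1) (above 2)
  | 1 => r3Label c c' n i 1 (above 0) (above 2)
  | 2 => r3Label c c' n i 2 (above 0) (above 1)

/-- The value `± θ(bottom, middle, top)` at the triple point of the move `r3 ab ac bc i`, where
the colors are those at the region from which all the normals point away (the color of the middle
sheet does not change at the bottom sheet, and that of the top sheet does not change at all).
The sign is positive if and only if the normals of the top, middle and bottom sheets, in this
order, are a right-handed frame; the normals that point to the right of the strands `a`, `b`, `c`
form a right-handed frame if the move is applied forwards. -/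
def tripleValue (c c' : List (List Label)) (n : ℕ) (ab ac bc : Bool) (i : ℕ) : ZMod 3 :=
  let up (s : Fin 3) : Bool := (r3Label c c' n i s false false).up
  let sg (s : Fin 3) : ZMod 3 := if up s then 1 else -1
  let o := r3Order ab ac bc
  orderSign o * sg 0 * sg 1 * sg 2 *
    theta (r3Source c c' n i up o.2.2).color (r3Source c c' n i up o.2.1).color
      (r3Source c c' n i up o.1).color

/-- The value at the singular point that is shown by a step: only triple points contribute, since
the cocycles for the other `0`-dimensional multiple points are taken to be zero. -/
def Step.value (s : Step) (c c' : List (List Label)) : ZMod 3 :=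
  match s.move with
  | .r3 ab ac bc i =>
    if s.fwd then tripleValue c c' s.start ab ac bc i else -tripleValue c' c s.start ab ac bc i
  | _ => 0

/-- The sum of the values at all the singular points of a movie. -/
def movieValue : List Step → List (List (List Label)) → ZMod 3
  | s :: ss, c :: c' :: C => s.value c c' + movieValue ss (c' :: C)
  | _, _ => 0

/-- The value of a coloring of a foam. -/
def Foam.Coloring.value {F : Foam} (C : F.Coloring) : ZMod 3 := movieValue F.steps C.1

/-- The quandle cocycle invariant: the multiset of the values of all the colorings. -/
noncomputable def Foam.cocycleInvariant (F : Foam) : Multiset (ZMod 3) :=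
  ∑ᶠ C : F.Coloring, {C.value}

/-! ## Twist-spinning

`T` is a diagram with one end below and one above.  A full twist of `T` around the line through its
two ends is shown by the following movie.  A kink (a loop with one crossing) is born in the strand
above `T`.  Then `T` is moved along this strand through the kink: it passes the crossing above the
other strand, goes once around the loop, passes the crossing below the other strand, and leaves the
kink, which then dies.  So each crossing of `T` gives two triple points for each full twist. -/

section Twist

variable (T : Diagram)

/-- The layer number `q` of `T`. -/
def layer (q : ℕ) : Gen := T.getD q (cup 0)

/-- The number of strands of `T` below the layer number `q`. -/
def strands (q : ℕ) : ℕ := (topWidth 1 (T.take q)).getD 0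

/-- The numbers of the layers of `T`, from top to bottom. -/
def layersDown : List ℕ := (List.range T.length).reverse

/-- The number of strands of `T` to the right of the piece in layer `q`. -/
def rightOf (q : ℕ) : ℕ := strands T q - (layer T q).pos - (layer T q).kind.inn

/-- From `T, cup 1` to `cup 1, T`: the minimum of the kink moves below `T`. -/
def lowerCup : List Step :=
  (layersDown T).map fun q => ⟨q, .far (layer T q) (cup (strands T (q + 1))), true⟩

/-- From `cup 1, T, cross true 0` to `cup 1, cross true 0, T`: here `T` moves from position `0` to
position `1`, over the other strand. -/
def passOver : List Step :=
  (layersDown T).flatMap fun q =>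
    let g := layer T q
    let j := g.pos
    let R := rightOf T q
    (List.range R).map (fun t =>
      (⟨1 + q + t, .far g (cross true (strands T (q + 1) - 1 - t)), true⟩ : Step)) ++
    [⟨1 + q + R, (match g.kind with
        | .cross o => .r3 o true true j
        | _ => .slideL true g), true⟩] ++
    (List.range j).map (fun t =>
      (⟨1 + q + R + g.kind.inn + t, .far (cross true (j - 1 - t)) ⟨g.kind, j + 1⟩, false⟩ : Step))

/-- The layer `q` of `T`, turned by `π` around the maximum of the loop, while `k` strands of `T`
are still on the left. -/
def turned (q k : ℕ) : Gen := ⟨(layer T q).kind.rot, 1 + k + rightOf T q⟩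

/-- `T` goes over the maximum of the loop: from `cup 1, cross true 0, T, cap 1` to
`cup 1, cross true 0, T', cap 1`, where `T` is in position `1` and `T'`, which is `T` turned by
the angle `π`, is in position `2`. -/
def turnOver : List Step :=
  (layersDown T).flatMap fun q =>
    let g : Gen := ⟨(layer T q).kind, 1 + (layer T q).pos⟩
    let R := rightOf T q
    let k := strands T q
    let k' := strands T (q + 1)
    let n := T.length + 1
    (List.range (T.length - 1 - q)).map (fun t =>
      (⟨2 + q + t, .far g (turned T (T.length - 1 - t) k'), true⟩ : Step)) ++
    (List.range R).map (fun t => (⟨n + t, .far g (cap (k' - t)), true⟩ : Step)) ++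
    [⟨n + R, .turnCap g, true⟩] ++
    (List.range R).map (fun t => (⟨n + (R - 1 - t),
      .far (cap (k - (R - 1 - t))) ⟨g.kind.rot, g.pos + g.kind.inn + 2 * t⟩, true⟩ : Step))

/-- `T'` passes to the right of the crossing of the kink: from `cup 1, cross true 0, T', cap 1` to
`cup 1, T', cross true 0, cap 1`. -/
def passBeside : List Step :=
  (List.range T.length).map fun t =>
    ⟨1 + t, .far (cross true 0) (turned T (T.length - 1 - t) 1), true⟩

/-- `T'` goes under the minimum of the loop: from `cup 1, T', cross true 0, cap 1`
to `cup 1, T, cross true 0, cap 1`, where `T` is in position `1`. -/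
def turnUnder : List Step :=
  (layersDown T).flatMap fun q =>
    let g : Gen := ⟨(layer T q).kind, 1 + (layer T q).pos⟩
    let j := (layer T q).pos
    let R := rightOf T q
    let k := strands T q
    let k' := strands T (q + 1)
    (List.range R).map (fun t => (⟨k' - 1 - t,
      .far (cup (k' - t)) ⟨g.kind.rot, 1 + k' + R - 2 * t⟩, true⟩ : Step)) ++
    [⟨j, .turnCup g, true⟩] ++
    (List.range R).map (fun t =>
      (⟨j + g.kind.inn + t, .far g (cup (g.pos + g.kind.out + t)), true⟩ : Step)) ++
    (List.range q).map (fun t => (⟨k + t, .far g (turned T (q - 1 - t) k'), true⟩ : Step))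

/-- From `cup 1, T, cross true 0` to `cup 1, cross true 0, T`: here `T` moves from position `1` to
position `0`, under the other strand. -/
def passUnder : List Step :=
  (layersDown T).flatMap fun q =>
    let g := layer T q
    let j := g.pos
    (List.range j).map (fun t =>
      (⟨1 + q + t, .far (cross true t) ⟨g.kind, j + 1⟩, false⟩ : Step)) ++
    (match g.kind with
      | .cross o => [⟨1 + q + j, .r3 true true o j, false⟩]
      | _ => [⟨1 + q + j, .slideR true g, true⟩]) ++
    (List.range (rightOf T q)).map (fun t =>
      (⟨1 + q + j + g.kind.inn + t, .far g (cross true (j + g.kind.out + t)), true⟩ : Step))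

/-- From `T, cap 1` to `cap 1, T`: the maximum of the kink moves below `T`. -/
def lowerCap : List Step :=
  (layersDown T).map fun q => ⟨2 + q, .far (layer T q) (cap (strands T (q + 1))), true⟩

/-- A full twist of `T`. -/
def fullTwist : List Step :=
  [⟨T.length, .r1 false true 0, false⟩] ++ lowerCup T ++ passOver T ++ turnOver T ++
    passBeside T ++ turnUnder T ++ passUnder T ++ lowerCap T ++ [⟨0, .r1 false true 0, true⟩]

/-- The `r`-twist-spin of the trivalent graph that is represented by `T` (with its ends joined):
while the page goes once around the axis, `T` makes `r` full twists. -/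
def twistSpin (r : ℕ) (h : run T (fullTwist T) = some T) : Foam :=
  ⟨T, (List.replicate r (fullTwist T)).flatten, run_replicate h r⟩

end Twist

/-! ## The handlebody-knot `5₂` -/

/-- The trivalent graph that represents the handlebody-knot `5₂`: a trefoil (the three crossings
`cross true _`) with an arc that joins two points of it and that hooks the trefoil on its way (the
crossings `cross false 0, cross false 0` in the first case, `cross false 1, cross true 0` between the
second `split` and the first `cap` in the second case).  The graph is cut open at a point of one of
the two edges that form the trefoil; the truth value chooses this edge. -/
def graph52 : Bool → Diagram
  | true => [cup 1, cross true 0, split 0, cross true 1, cross false 0, cross false 0,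
      cross true 1, merge 0, cap 1]
  | false => [split 0, cup 2, cross true 1, split 1, cross true 2, cross false 1, cross true 0,
      cap 1, cross true 0, cap 1]

/-- The `2`-twist-spin of the trivalent graph that represents the handlebody-knot `5₂`. -/
def foam52 (e : Bool) : Foam :=
  twistSpin (graph52 e) 2 (by cases e <;> decide +kernel)

end KnottedFoam

/-! ## Evaluation in the kernel

The following functions are defined by recursors, which the kernel unfolds quickly. -/

/-! Why the values are as stated: only sheets with second component 1 act on others, and `theta`
vanishes unless all three sheets are of this kind. By the vertex rule, the edges of the graph that
carry 1 form the empty set or one of its three cycles. In the empty case the first component is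
constant, which leaves 3 colors and 8 orientations. A cycle has 2 consistent orientations and the
remaining edge has 2, so each cycle gives 4 times the number of its `R₃`-colorings: 3 constant ones
for each of the two unknotted cycles, 9 for the trefoil. The 24 + 12 + 12 + 12 constant colorings
have value 0, because `theta3 a a c = 0`. On the other 24 the value is that of the 2-twist-spun
trefoil for Mochizuki's cocycle: the same nonzero value on all nonconstant colorings for one
orientation of the trefoil, and its negative for the other. This gives 12 and 12.

Two twists close up because, in one full twist, the tangle passes once under the strand of its lower
end. This translates its colors by the color of that strand, and translations of `R̃` are
involutions.

The formal proof replaces this count by an exhaustive computation on codes. `Gen.mem_next` and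
`Diagram.mem_between` show that a search finds exactly the colorings of a diagram with given lowest
and highest level. By `Step.next_spec` a coloring extends uniquely over a step whenever this search
has one result, and `movieRun_spec` iterates this over a movie and adds up the values. If every
admissible coloring of the first still returns to itself, restriction to the first still is a
bijection from the colorings of the foam (`Foam.cocycleInvariant_eq`), and the invariant is the list
of computed values. -/

namespace KnottedFoam

/-- `k n`, in a form in which the kernel evaluates `n` before it passes it to `k`. -/
def force {α : Type*} (n : ℕ) (k : ℕ → α) : α := Nat.rec (k 0) (fun m _ => k (Nat.succ m)) n

def mapRec {α β : Type*} (f : α → β) (l : List α) : List β :=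
  List.rec [] (fun a _ ih => f a :: ih) l

def appendRec {α : Type*} (l l' : List α) : List α := List.rec l' (fun a _ ih => a :: ih) l

/-- The last element is treated separately to avoid an append to the empty list; crossings, for
instance, allow at most one continuation. -/
def flatMapRec {α β : Type*} (f : α → List β) (l : List α) : List β :=
  List.rec [] (fun a r ih => List.rec (f a) (fun _ _ _ => appendRec (f a) ih) r) l

def reverseRec {α : Type*} (l : List α) : List α → List α :=
  List.rec (fun r => r) (fun a _ ih r => ih (a :: r)) l

def anyRec {α : Type*} (f : α → Bool) (l : List α) : Bool :=
  List.rec false (fun a _ ih => bif f a then true else ih) l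

theorem force_eq {α : Type*} (n : ℕ) (k : ℕ → α) : force n k = k n := by cases n <;> rfl

theorem mapRec_eq {α β : Type*} (f : α → β) (l : List α) : mapRec f l = l.map f := by
  induction l with
  | nil => rfl
  | cons a l ih => rw [List.map_cons, ← ih]; rfl

theorem appendRec_eq {α : Type*} (l l' : List α) : appendRec l l' = l ++ l' := by
  induction l with
  | nil => rfl
  | cons a l ih => rw [List.cons_append, ← ih]; rfl

theorem flatMapRec_eq {α β : Type*} (f : α → List β) (l : List α) :
    flatMapRec f l = l.flatMap f := by
  induction l with
  | nil => rfl
  | cons a l ih =>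
    cases l with
    | nil => simp [flatMapRec]
    | cons b l => rw [List.flatMap_cons, ← ih, ← appendRec_eq]; rfl

theorem reverseRec_eq {α : Type*} (l r : List α) : reverseRec l r = l.reverse ++ r := by
  induction l generalizing r with
  | nil => rfl
  | cons a l ih =>
    rw [List.reverse_cons, List.append_assoc, List.singleton_append, ← ih]; rfl

theorem anyRec_eq_false {α : Type*} {f : α → Bool} {l : List α} (h : anyRec f l = false) :
    ∀ a ∈ l, f a = false := by
  induction l with
  | nil => simp
  | cons b l ih =>
    have h' : (bif f b then true else anyRec f l) = false := h
    cases hb : f b <;> simp_all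

/-! ## Codes of labels and levels

A label is encoded by one of the numbers `1, …, 12`, a level of a coloring by a number with these
digits in base `16`. -/

def Label.code (x : Label) : ℕ :=
  1 + x.color.1.val + 3 * (Multiplicative.toAdd x.color.2).val + bif x.up then 0 else 6

/-- Whether the second component of the color is the identity. -/
def isUnitCode (x : ℕ) : Bool := Nat.beq (Nat.mod (Nat.div (Nat.pred x) 3) 2) 0

def Label.decode (n : ℕ) : Label :=
  ⟨(bif Nat.beq (Nat.mod (Nat.pred n) 3) 0 then 0 else
      bif Nat.beq (Nat.mod (Nat.pred n) 3) 1 then 1 else 2,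
    bif isUnitCode n then 1 else Z2.one), Nat.ble n 6⟩

/-- The code of the label with the same color and the opposite orientation. -/
def flipCode (x : ℕ) : ℕ := bif Nat.ble 7 x then Nat.sub x 6 else Nat.add x 6

/-- The code of `u ◁ t`, with the orientation of `u`. -/
def actCode (t u : ℕ) : ℕ :=
  bif isUnitCode t then u
  -- In `ℤ/3`, `2b - a = 2(b + a)`, and the predecessor of a code is congruent to its element of
  -- `R₃` modulo 3.
  else Nat.add (Nat.succ (Nat.mod (Nat.mul 2 (Nat.add (Nat.pred t) (Nat.pred u))) 3))
    (Nat.mul 3 (Nat.div (Nat.pred u) 3))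

/-- The code of the label with the same element of `R₃`, the identity of `ℤ₂`, and the upward
orientation. -/
def baseCode (x : ℕ) : ℕ := Nat.succ (Nat.mod (Nat.pred x) 3)

def pairCode (x y : ℕ) : ℕ := Nat.add x (Nat.mul 16 y)

/-- The possible pairs of strands above a `split`. -/
def splitCodes (z a : ℕ) : List ℕ :=
  bif isUnitCode z then
    -- Starting from the base code, adding 3 changes the element of `ℤ₂` and adding 6 reverses the
    -- orientation.
    [pairCode a a, pairCode a (a.add 6), pairCode (a.add 6) a, pairCode (a.add 6) (a.add 6),
      pairCode (a.add 3) (a.add 9), pairCode (a.add 9) (a.add 3)]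
  else [pairCode z a, pairCode z (a.add 6), pairCode a z, pairCode (a.add 6) z]

/-- The possible strands above a `merge`. -/
def mergeCodes (x y a : ℕ) : List ℕ :=
  bif Nat.beq a (baseCode y) then
    bif isUnitCode x then bif isUnitCode y then [a, a.add 6] else [y]
    -- Two lower strands with equal codes both point to the vertex or both away from it, which is
    -- inconsistent if neither is a unit.
    else bif isUnitCode y then [x] else bif Nat.beq x y then [] else [a, a.add 6]
  else []

/-- The codes of the strands above an elementary piece, if `x` and `y` are the first two strands
below it. -/
def Kind.outputs (k : Kind) (x y : ℕ) : List ℕ :=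
  Kind.casesOn k
    -- The numbers `x + 16 * flipCode x` for `x = 1, …, 12`.
    [113, 130, 147, 164, 181, 198, 23, 40, 57, 74, 91, 108]
    (bif Nat.beq y (flipCode x) then [0] else [])
    (fun o => bif Nat.beq y 0 then [] else
      bif o then [pairCode (actCode x y) x] else [pairCode y (actCode y x)])
    (bif Nat.beq x 0 then [] else splitCodes x (baseCode x))
    (bif Nat.beq y 0 then [] else mergeCodes x y (baseCode x))

/-- Here `P = 16 ^ pos`, while `lo` and `h` hold the digits below and from position `pos` on. As no
label has code 0, the test `P ≤ 16 * lo + 1` says that `lo` really has `pos` digits, that is, that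
enough strands lie on the left. -/
def nextAbove (k : Kind) (P lo h : ℕ) : List ℕ :=
  bif Nat.ble P (Nat.succ (Nat.mul 16 lo)) then
    mapRec (fun p => Nat.add lo (Nat.mul P
        (Nat.add p (Nat.mul (Nat.pow 16 k.out) (Nat.div h (Nat.pow 16 k.inn))))))
      (force (Nat.mod h 16) fun x => force (Nat.mod (Nat.div h 16) 16) fun y => k.outputs x y)
  else []

def nextSplit (k : Kind) (P l : ℕ) : List ℕ := nextAbove k P (Nat.mod l P) (Nat.div l P)

/-- The codes of the levels that are allowed above a layer. -/
def Gen.next (g : Gen) (l : ℕ) : List ℕ := nextSplit g.kind (Nat.pow 16 g.pos) l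

/-! ### Injectivity and digits of the codes of labels and levels. -/

theorem Label.decode_code (x : Label) : Label.decode x.code = x := by
  obtain ⟨⟨a, g⟩, u⟩ := x
  revert a g u
  decide

theorem Label.decode_zero : Label.decode 0 = default := by decide

theorem Label.code_injective : Function.Injective Label.code :=
  Function.LeftInverse.injective Label.decode_code

theorem Label.code_pos (x : Label) : 0 < x.code := by
  simp only [Label.code]; omega

theorem Label.code_lt (x : Label) : x.code < 13 := by
  obtain ⟨⟨a, g⟩, u⟩ := x
  revert a g u
  decide

instance : Fintype Label :=
  Fintype.ofEquiv (RTilde × Bool)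
    ⟨fun p => ⟨p.1, p.2⟩, fun x => (x.color, x.up), fun _ => rfl, fun _ => rfl⟩

instance (x y z : RTilde) (x' y' z' : Bool) : Decidable (EdgeRule x y z x' y' z') := by
  unfold EdgeRule; infer_instance

instance (t : Label) (u v : RTilde) : Decidable (CrossRule t u v) := by
  unfold CrossRule; infer_instance

/-- The code of a list of labels. -/
def levelCode (l : List Label) : ℕ := Nat.ofDigits 16 (l.map Label.code)

@[simp] theorem levelCode_nil : levelCode [] = 0 := rfl

@[simp] theorem levelCode_cons (x : Label) (l : List Label) :
    levelCode (x :: l) = x.code + 16 * levelCode l := by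
  simp [levelCode, Nat.ofDigits_cons]

theorem levelCode_append (l l' : List Label) :
    levelCode (l ++ l') = levelCode l + 16 ^ l.length * levelCode l' := by
  simp [levelCode, Nat.ofDigits_append]

theorem levelCode_lt (l : List Label) : levelCode l < 16 ^ l.length := by
  induction l with
  | nil => simp
  | cons x l ih =>
    have := x.code_lt
    simp only [levelCode_cons, List.length_cons, pow_succ]
    omega

/-- All digits are nonzero, so the leading one already gives this bound. It justifies the test in
`nextAbove`. -/
theorem le_levelCode (l : List Label) : 16 ^ l.length ≤ 16 * levelCode l + 1 := by
  induction l with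
  | nil => simp
  | cons x l ih =>
    have := x.code_pos
    simp only [levelCode_cons, List.length_cons, pow_succ]
    omega

/-- Since 0 is not a digit, the number of strands can be recovered from the code. -/
theorem levelCode_injective : Function.Injective levelCode := by
  intro l l' h
  induction l generalizing l' with
  | nil =>
    cases l' with
    | nil => rfl
    | cons y l' => have := y.code_pos; simp at h; omega
  | cons x l ih =>
    cases l' with
    | nil => have := x.code_pos; simp at h; omega
    | cons y l' =>
      have hx := x.code_lt
      have hy := y.code_lt
      simp only [levelCode_cons] at h
      rw [Label.code_injective (show x.code = y.code by omega),
        ih (show levelCode l = levelCode l' by omega)]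

theorem levelCode_append_mod (l l' : List Label) :
    levelCode (l ++ l') % 16 ^ l.length = levelCode l := by
  rw [levelCode_append, Nat.add_mul_mod_self_left, Nat.mod_eq_of_lt (levelCode_lt l)]

theorem levelCode_append_div (l l' : List Label) :
    levelCode (l ++ l') / 16 ^ l.length = levelCode l' := by
  rw [levelCode_append, Nat.add_mul_div_left _ _ (by positivity),
    Nat.div_eq_of_lt (levelCode_lt l), zero_add]

theorem levelCode_mod_cons (x : Label) (l : List Label) :
    levelCode (x :: l) % 16 = x.code := by
  have := x.code_lt
  rw [levelCode_cons]; omega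

theorem levelCode_div_cons (x : Label) (l : List Label) :
    levelCode (x :: l) / 16 = levelCode l := by
  have := x.code_lt
  rw [levelCode_cons]; omega

/-! ### Correctness of the transitions -/

/-- Translations of `R̃` are involutions, so the color on the far side is obtained by acting with
the over-color, whatever the direction of the normal. -/
theorem crossRule_left (x y : Label) (v : RTilde) :
    CrossRule x v y.color ↔ v = y.color.op x.color := by
  revert x y v; decide +kernel

theorem crossRule_right (x y : Label) (v : RTilde) :
    CrossRule y x.color v ↔ v = x.color.op y.color := by
  revert x y v; decide +kernel

theorem actCode_code (t u : Label) :
    actCode t.code u.code = Label.code ⟨u.color.op t.color, u.up⟩ := by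
  revert t u; decide +kernel

theorem flipCode_code (x y : Label) :
    Nat.beq y.code (flipCode x.code) = true ↔ x.color = y.color ∧ x.up ≠ y.up := by
  revert x y; decide +kernel

theorem mem_outputs_cup (x y : Label) (a b : ℕ) :
    x.code + 16 * y.code ∈ Kind.outputs .cup a b ↔ x.color = y.color ∧ x.up ≠ y.up := by
  have h : ∀ x y : Label, x.code + 16 * y.code ∈ Kind.outputs .cup 0 0 ↔
    x.color = y.color ∧ x.up ≠ y.up := by decide +kernel
  exact h x y

theorem exists_of_mem_outputs_cup {p a b : ℕ} (hp : p ∈ Kind.outputs .cup a b) :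
    ∃ x y : Label, p = x.code + 16 * y.code := by
  have h : ∀ p ∈ Kind.outputs .cup 0 0, ∃ x y : Label, p = x.code + 16 * y.code := by
    decide +kernel
  exact h p hp

theorem mem_outputs_split (x y z : Label) (b : ℕ) :
    x.code + 16 * y.code ∈ Kind.outputs .split z.code b ↔
      EdgeRule x.color y.color z.color (!x.up) (!y.up) z.up := by
  have h : ∀ x y z : Label, x.code + 16 * y.code ∈ Kind.outputs .split z.code 0 ↔
    EdgeRule x.color y.color z.color (!x.up) (!y.up) z.up := by decide +kernel
  exact h x y z

theorem exists_of_mem_outputs_split {z : Label} {p b : ℕ}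
    (hp : p ∈ Kind.outputs .split z.code b) : ∃ x y : Label, p = x.code + 16 * y.code := by
  have h : ∀ z : Label, ∀ p ∈ Kind.outputs .split z.code 0,
    ∃ x y : Label, p = x.code + 16 * y.code := by decide +kernel
  exact h z p hp

theorem mem_outputs_merge (x y z : Label) :
    z.code ∈ Kind.outputs .merge x.code y.code ↔
      EdgeRule x.color y.color z.color x.up y.up (!z.up) := by
  revert x y z; decide +kernel

theorem exists_of_mem_outputs_merge {x y : Label} {p : ℕ}
    (hp : p ∈ Kind.outputs .merge x.code y.code) : ∃ z : Label, p = z.code := by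
  have h : ∀ x y : Label, ∀ p ∈ Kind.outputs .merge x.code y.code, ∃ z : Label, p = z.code := by
    decide +kernel
  exact h x y p hp

theorem Kind.Rule.length {k : Kind} {l l' : List Label} (h : k.Rule l l') :
    l.length = k.inn ∧ l'.length = k.out := by
  unfold Kind.Rule at h
  split at h <;> simp_all [Kind.inn, Kind.out]

/-- Two digits are always read. Those that belong to `B` and not to `X` do not influence the result.
-/
theorem Kind.mem_outputs (k : Kind) {X : List Label} (B : List Label) (hX : X.length = k.inn)
    (p : ℕ) :
    p ∈ k.outputs (levelCode (X ++ B) % 16) (levelCode (X ++ B) / 16 % 16) ↔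
      ∃ X', p = levelCode X' ∧ k.Rule X X' := by
  cases k with
  | cup =>
    obtain rfl := List.length_eq_zero_iff.1 hX
    constructor
    · intro hp
      obtain ⟨x, y, rfl⟩ := exists_of_mem_outputs_cup hp
      exact ⟨[x, y], by simp, (mem_outputs_cup x y _ _).1 hp⟩
    · rintro ⟨X', rfl, h⟩
      obtain ⟨x, y, rfl⟩ := List.length_eq_two.1 h.length.2
      simpa using (mem_outputs_cup x y _ _).2 h
  | cap =>
    obtain ⟨x, y, rfl⟩ := List.length_eq_two.1 hX
    rw [List.cons_append, List.cons_append, levelCode_mod_cons, levelCode_div_cons,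
      levelCode_mod_cons]
    have key := flipCode_code x y
    have e : Kind.outputs .cap x.code y.code =
      bif Nat.beq y.code (flipCode x.code) then [0] else [] := rfl
    rw [e]
    constructor
    · intro hp
      cases hb : Nat.beq y.code (flipCode x.code) with
      | false => simp [hb] at hp
      | true =>
        rw [hb] at hp
        exact ⟨[], by simpa using hp, key.1 hb⟩
    · rintro ⟨X', rfl, h⟩
      obtain rfl := List.length_eq_zero_iff.1 h.length.2
      rw [key.2 h]
      simp
  | cross o =>
    obtain ⟨x, y, rfl⟩ := List.length_eq_two.1 hX
    rw [List.cons_append, List.cons_append, levelCode_mod_cons, levelCode_div_cons,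
      levelCode_mod_cons]
    have hy : Nat.beq y.code 0 = false := by
      have := y.code_pos
      rw [Bool.eq_false_iff, Ne, Nat.beq_eq]; omega
    cases o with
    | true =>
      have e : Kind.outputs (.cross true) x.code y.code = bif Nat.beq y.code 0 then [] else
        [actCode x.code y.code + 16 * x.code] := rfl
      rw [e, hy, actCode_code]
      simp only [cond_false, List.mem_singleton]
      constructor
      · rintro rfl
        exact ⟨[⟨y.color.op x.color, y.up⟩, x], by simp, rfl, rfl, (crossRule_left x y _).2 rfl⟩
      · rintro ⟨X', rfl, h⟩
        obtain ⟨⟨c, u⟩, z, rfl⟩ := List.length_eq_two.1 h.length.2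
        obtain ⟨rfl, h2, h3⟩ := h
        obtain rfl := (crossRule_left _ _ _).1 h3
        simp only at h2
        simp [h2]
    | false =>
      have e : Kind.outputs (.cross false) x.code y.code = bif Nat.beq y.code 0 then [] else
        [y.code + 16 * actCode y.code x.code] := rfl
      rw [e, hy, actCode_code]
      simp only [cond_false, List.mem_singleton]
      constructor
      · rintro rfl
        exact ⟨[y, ⟨x.color.op y.color, x.up⟩], by simp, rfl, rfl, (crossRule_right x y _).2 rfl⟩
      · rintro ⟨X', rfl, h⟩
        obtain ⟨z, ⟨c, u⟩, rfl⟩ := List.length_eq_two.1 h.length.2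
        obtain ⟨rfl, h2, h3⟩ := h
        obtain rfl := (crossRule_right _ _ _).1 h3
        simp only at h2
        simp [h2]
  | split =>
    obtain ⟨z, rfl⟩ := List.length_eq_one_iff.1 hX
    rw [List.cons_append, levelCode_mod_cons]
    constructor
    · intro hp
      obtain ⟨x, y, rfl⟩ := exists_of_mem_outputs_split hp
      exact ⟨[x, y], by simp, (mem_outputs_split x y z _).1 hp⟩
    · rintro ⟨X', rfl, h⟩
      obtain ⟨x, y, rfl⟩ := List.length_eq_two.1 h.length.2
      simpa using (mem_outputs_split x y z _).2 h
  | merge =>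
    obtain ⟨x, y, rfl⟩ := List.length_eq_two.1 hX
    rw [List.cons_append, List.cons_append, levelCode_mod_cons, levelCode_div_cons,
      levelCode_mod_cons]
    constructor
    · intro hp
      obtain ⟨z, rfl⟩ := exists_of_mem_outputs_merge hp
      exact ⟨[z], by simp, (mem_outputs_merge x y z).1 hp⟩
    · rintro ⟨X', rfl, h⟩
      obtain ⟨z, rfl⟩ := List.length_eq_one_iff.1 h.length.2
      simpa using (mem_outputs_merge x y z).2 h

/-- A missing strand is read as the digit 0, which is not the code of a label and is rejected by
every piece that needs the strand. -/
theorem Kind.outputs_eq_nil (k : Kind) {l : List Label} (hl : l.length < k.inn) :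
    k.outputs (levelCode l % 16) (levelCode l / 16 % 16) = [] := by
  have h0 : k.inn ≤ 2 := by cases k <;> simp [Kind.inn]
  have h1 : ∀ x : Label, Nat.beq 0 (flipCode x.code) = false := by decide +kernel
  match l, hl with
  | [], hl => cases k <;> first | rfl | simp [Kind.inn] at hl
  | [x], hl =>
    rw [levelCode_div_cons, levelCode_mod_cons]
    cases k with
    | cap =>
      change (bif Nat.beq 0 (flipCode x.code) then [0] else []) = []
      rw [h1]; rfl
    | cup => simp [Kind.inn] at hl
    | split => simp [Kind.inn] at hl
    | cross o => rfl
    | merge => rfl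
  | x :: y :: l, hl => simp at hl; omega

/-- If `l` has enough strands, it splits uniquely into the part left of the piece, the input of the
piece and the rest, and so do its digits. Otherwise no level fits, and the list is empty by the test
in `nextAbove` or by `Kind.outputs_eq_nil`. -/
theorem Gen.mem_next (g : Gen) (l : List Label) (n : ℕ) :
    n ∈ g.next (levelCode l) ↔ ∃ l', n = levelCode l' ∧ g.Rule l l' := by
  have e : g.next (levelCode l) =
      bif Nat.ble (16 ^ g.pos) (16 * (levelCode l % 16 ^ g.pos) + 1) then
        (g.kind.outputs (levelCode l / 16 ^ g.pos % 16) (levelCode l / 16 ^ g.pos / 16 % 16)).map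
          fun p => levelCode l % 16 ^ g.pos + 16 ^ g.pos *
            (p + 16 ^ g.kind.out * (levelCode l / 16 ^ g.pos / 16 ^ g.kind.inn))
      else [] := by
    simp only [Gen.next, nextSplit, nextAbove, mapRec_eq, force_eq]
    rfl
  rw [e]
  by_cases hp : g.pos ≤ l.length
  · obtain ⟨A, D, hA, rfl⟩ : ∃ A D, A.length = g.pos ∧ l = A ++ D :=
      ⟨l.take g.pos, l.drop g.pos, by simpa using hp, by simp⟩
    rw [← hA, levelCode_append_mod, levelCode_append_div,
      Nat.ble_eq_true_of_le (le_levelCode A), cond_true]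
    by_cases hD : g.kind.inn ≤ D.length
    · obtain ⟨X, B, hX, rfl⟩ : ∃ X B, X.length = g.kind.inn ∧ D = X ++ B :=
        ⟨D.take g.kind.inn, D.drop g.kind.inn, by simpa using hD, by simp⟩
      rw [← hX, levelCode_append_div]
      simp only [List.mem_map, Kind.mem_outputs _ B hX]
      constructor
      · rintro ⟨p, ⟨X', rfl, h⟩, rfl⟩
        refine ⟨A ++ X' ++ B, ?_, A, B, X, X', hA, by simp, rfl, h⟩
        rw [← h.length.2, ← levelCode_append, ← levelCode_append, List.append_assoc]
      · rintro ⟨l', rfl, A₂, B₂, X₂, X', hA₂, h₂, rfl, h⟩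
        rw [List.append_assoc] at h₂
        obtain ⟨rfl, h₃⟩ := List.append_inj h₂ (hA.trans hA₂.symm)
        obtain ⟨rfl, rfl⟩ := List.append_inj h₃ (hX.trans h.length.1.symm)
        refine ⟨_, ⟨X', rfl, h⟩, ?_⟩
        rw [← h.length.2, ← levelCode_append, ← levelCode_append, List.append_assoc]
    · rw [Kind.outputs_eq_nil _ (by omega)]
      simp only [List.map_nil, List.not_mem_nil, false_iff, not_exists, not_and]
      rintro l' - ⟨A₂, B₂, X₂, X', hA₂, h₂, rfl, h⟩
      have h₃ := congrArg List.length h₂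
      have := h.length.1
      simp at h₃; omega
  · have hlt : levelCode l < 16 ^ l.length := levelCode_lt l
    have hle : 16 ^ (l.length + 1) ≤ 16 ^ g.pos := Nat.pow_le_pow_right (by norm_num) (by omega)
    rw [pow_succ] at hle
    rw [Nat.mod_eq_of_lt (by omega)]
    have : Nat.ble (16 ^ g.pos) (16 * levelCode l + 1) = false := by
      rw [Bool.eq_false_iff, Ne, Nat.ble_eq]; omega
    rw [this]
    simp only [cond_false, List.not_mem_nil, false_iff, not_exists, not_and]
    rintro l' - ⟨A₂, B₂, X₂, X', hA₂, rfl, rfl, h⟩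
    simp at hp; omega

/-! ## Enumeration of colorings -/

/-- The codes of all the colorings of `w` that start with the level `l` and end with a level that
satisfies `p`. -/
def Diagram.extend (p : ℕ → Bool) (w : Diagram) : ℕ → List (List ℕ) :=
  List.rec (fun l => bif p l then [[l]] else [])
    (fun g _ ih l => flatMapRec (fun l' => mapRec (l :: ·) (force l' ih)) (g.next l)) w

/-- The reflection exchanges the two diagonals of a crossing, so the over-strand now starts on the
other side. -/
def Kind.mirror : Kind → Kind
  | .cup => .cap | .cap => .cup | .cross o => .cross (!o) | .split => .merge | .merge => .split

def Gen.mirror (g : Gen) : Gen := ⟨g.kind.mirror, g.pos⟩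

/-- The reflection of a diagram at a horizontal line. -/
def Diagram.mirror (w : Diagram) : Diagram := (w.map Gen.mirror).reverse

def Kind.isCup : Kind → Bool
  | .cup => true
  | _ => false

/-- The codes of all the colorings of `w` with lowest level `l` and highest level `l'`.  Diagrams
with minima are searched from above, since a minimum can be colored in many ways. -/
def Diagram.between (w : Diagram) (l l' : ℕ) : List (List ℕ) :=
  bif w.any (fun g => g.kind.isCup) then
    mapRec (fun m => reverseRec m []) (Diagram.extend (Nat.beq l) (Diagram.mirror w) l')
  else Diagram.extend (Nat.beq l') w l

/-! ### Correctness of the search for colorings. -/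

theorem Diagram.IsColoring.length {w : Diagram} {c : List (List Label)}
    (h : Diagram.IsColoring w c) : c.length = w.length + 1 := by
  induction w generalizing c with
  | nil =>
    match c, h with
    | [_], _ => rfl
  | cons g w ih =>
    match c, h with
    | l :: l' :: c, h => simpa using ih h.2

theorem Diagram.isColoring_nil {c : List (List Label)} :
    Diagram.IsColoring [] c ↔ ∃ l, c = [l] := by
  match c with
  | [] => simp [Diagram.IsColoring]
  | [_] => simp [Diagram.IsColoring]
  | _ :: _ :: _ => simp [Diagram.IsColoring]

theorem Diagram.isColoring_cons {g : Gen} {w : Diagram} {c : List (List Label)} :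
    Diagram.IsColoring (g :: w) c ↔
      ∃ l c', c = l :: c' ∧ Diagram.IsColoring w c' ∧ ∃ l', c'.head? = some l' ∧ g.Rule l l' := by
  match c with
  | [] => simp [Diagram.IsColoring]
  | [_] =>
    simp only [Diagram.IsColoring, false_iff]
    rintro ⟨l, c', h, hc, -⟩
    have := hc.length
    simp_all
  | l :: l' :: c =>
    simp [Diagram.IsColoring, and_comm]

theorem Diagram.extend_nil (p : ℕ → Bool) (l : ℕ) :
    Diagram.extend p [] l = if p l then [[l]] else [] := by
  cases h : p l <;> simp [Diagram.extend, h]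

theorem Diagram.extend_cons (p : ℕ → Bool) (g : Gen) (w : Diagram) (l : ℕ) :
    Diagram.extend p (g :: w) l =
      (g.next l).flatMap fun l' => (Diagram.extend p w l').map (l :: ·) := by
  rw [← flatMapRec_eq]
  simp only [← mapRec_eq]
  change flatMapRec (fun l' => mapRec (l :: ·) (force l' (Diagram.extend p w))) (g.next l) = _
  simp only [force_eq]

theorem Diagram.mem_extend (p : ℕ → Bool) (w : Diagram) (l : List Label) (m : List ℕ) :
    m ∈ Diagram.extend p w (levelCode l) ↔
      ∃ c, m = c.map levelCode ∧ Diagram.IsColoring w c ∧ c.head? = some l ∧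
        ∃ l', c.getLast? = some l' ∧ p (levelCode l') = true := by
  induction w generalizing l m with
  | nil =>
    rw [Diagram.extend_nil]
    constructor
    · intro h
      split at h
      · rename_i hp
        exact ⟨[l], by simpa using h, trivial, rfl, l, rfl, hp⟩
      · simp at h
    · rintro ⟨c, rfl, hc, hl, l', hl', hp⟩
      obtain ⟨l₀, rfl⟩ := Diagram.isColoring_nil.1 hc
      simp at hl hl'
      subst hl hl'
      simp [hp]
  | cons g w ih =>
    simp only [Diagram.extend_cons, List.mem_flatMap, Gen.mem_next, List.mem_map]
    constructor
    · rintro ⟨_, ⟨l', rfl, hg⟩, m', hm', rfl⟩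
      obtain ⟨c, rfl, hc, hl, l'', hl'', hp⟩ := (ih l' m').1 hm'
      have hne : c ≠ [] := by rintro rfl; simp at hl
      refine ⟨l :: c, by simp, Diagram.isColoring_cons.2 ⟨l, c, rfl, hc, l', hl, hg⟩, rfl, l'',
        ?_, hp⟩
      rw [List.getLast?_cons, hl'']; rfl
    · rintro ⟨c, rfl, hc, hl, l'', hl'', hp⟩
      obtain ⟨l₀, c, rfl, hc, l', hl', hg⟩ := Diagram.isColoring_cons.1 hc
      obtain rfl : l₀ = l := by simpa using hl
      refine ⟨_, ⟨l', rfl, hg⟩, c.map levelCode, (ih l' _).2 ⟨c, rfl, hc, hl', l'', ?_, hp⟩,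
        by simp⟩
      have hne : c ≠ [] := by rintro rfl; simp at hl'
      obtain ⟨b, c, rfl⟩ := List.exists_cons_of_ne_nil hne
      simpa [List.getLast?_cons] using hl''

/-- Left and right are preserved, so labels can be kept if they are read as the side to which the
normal points. At a vertex all three truth values are negated, but `EdgeRule` only uses inequalities
between them. -/
theorem Kind.rule_mirror (k : Kind) (l l' : List Label) : k.mirror.Rule l' l ↔ k.Rule l l' := by
  constructor
  · intro h
    unfold Kind.Rule at h
    split at h <;> rename_i hk <;> cases k <;> simp [Kind.mirror] at hk <;>
      simp_all [Kind.Rule, EdgeRule, eq_comm] <;> (obtain ⟨rfl, -, h⟩ := h; exact h)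
  · intro h
    unfold Kind.Rule at h
    split at h <;> simp_all [Kind.Rule, Kind.mirror, EdgeRule, eq_comm] <;>
      (obtain ⟨rfl, -, h⟩ := h; exact h)

theorem Gen.rule_mirror (g : Gen) (l l' : List Label) : g.mirror.Rule l' l ↔ g.Rule l l' := by
  constructor
  · rintro ⟨A, B, x, x', hA, h, h', hr⟩
    exact ⟨A, B, x', x, hA, h', h, (Kind.rule_mirror _ _ _).1 hr⟩
  · rintro ⟨A, B, x, x', hA, h, h', hr⟩
    exact ⟨A, B, x', x, hA, h', h, (Kind.rule_mirror _ _ _).2 hr⟩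

theorem Diagram.isColoring_append (w w' : Diagram) (c : List (List Label)) :
    Diagram.IsColoring (w ++ w') c ↔
      Diagram.IsColoring w (c.take (w.length + 1)) ∧ Diagram.IsColoring w' (c.drop w.length) := by
  induction w generalizing c with
  | nil =>
    cases c with
    | nil => cases w' <;> simp [Diagram.IsColoring]
    | cons l c => simp [Diagram.IsColoring]
  | cons g w ih =>
    match c with
    | [] => simp [Diagram.IsColoring]
    | [_] => cases w' <;> simp [Diagram.IsColoring]
    | l :: l' :: c =>
      have := ih (l' :: c)
      simp only [List.take_succ_cons] at this
      simp [Diagram.IsColoring, this, and_assoc]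

theorem Diagram.isColoring_mirror (w : Diagram) (c : List (List Label)) :
    Diagram.IsColoring (Diagram.mirror w) c.reverse ↔ Diagram.IsColoring w c := by
  induction w generalizing c with
  | nil =>
    rw [Diagram.isColoring_nil, show Diagram.mirror [] = [] from rfl, Diagram.isColoring_nil]
    simp [List.reverse_eq_iff]
  | cons g w ih =>
    have e : Diagram.mirror (g :: w) = Diagram.mirror w ++ [g.mirror] := by
      simp [Diagram.mirror]
    have hw : (Diagram.mirror w).length = w.length := by simp [Diagram.mirror]
    rw [e, Diagram.isColoring_append, hw]
    match c with
    | [] => simp [Diagram.IsColoring]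
    | [l] => cases w <;> simp [Diagram.IsColoring]
    | l :: l' :: c =>
      by_cases hc : c.length = w.length
      · rw [Diagram.IsColoring, ← ih (l' :: c), ← Gen.rule_mirror]
        rw [List.reverse_cons (a := l), List.take_append_of_le_length (by simp [hc]),
          List.take_of_length_le (by simp [hc]), List.reverse_cons (a := l'), List.append_assoc,
          List.drop_left' (by simp [hc])]
        simp [Diagram.IsColoring, and_comm]
      · constructor
        · rintro ⟨h1, h2⟩
          have := h2.length
          simp at this; omega
        · intro h
          have := h.length
          simp at this; omega

theorem Diagram.mem_between (w : Diagram) (l l' : List Label) (m : List ℕ) :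
    m ∈ Diagram.between w (levelCode l) (levelCode l') ↔
      ∃ c, m = c.map levelCode ∧ Diagram.IsColoring w c ∧ c.head? = some l ∧
        c.getLast? = some l' := by
  unfold Diagram.between
  cases w.any (fun g => g.kind.isCup) with
  | false =>
    rw [cond_false, Diagram.mem_extend]
    simp only [Nat.beq_eq, levelCode_injective.eq_iff]
    simp
  | true =>
    rw [cond_true, mapRec_eq]
    simp only [List.mem_map, reverseRec_eq, List.append_nil, Diagram.mem_extend, Nat.beq_eq,
      levelCode_injective.eq_iff]
    constructor
    · rintro ⟨_, ⟨c, rfl, hc, hl, _, hl', rfl⟩, rfl⟩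
      refine ⟨c.reverse, by simp, ?_, by simpa using hl', by simpa using hl⟩
      rwa [← Diagram.isColoring_mirror, List.reverse_reverse]
    · rintro ⟨c, rfl, hc, hl, hl'⟩
      exact ⟨_, ⟨c.reverse, rfl, (Diagram.isColoring_mirror _ _).2 hc, by simpa using hl', l,
        by simpa using hl, rfl⟩, by simp⟩

/-! ## Continuation of a coloring along a movie -/

/-- The base in which the levels of a coloring are the digits of a number. -/
def levelBase : ℕ := 18446744073709551616

/-- The number that begins with the digits `m` and continues with those of `H`. -/
def packOnto (H : ℕ) (m : List ℕ) : ℕ :=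
  List.rec H (fun l _ ih => Nat.add l (Nat.mul levelBase ih)) m

/-- Fails unless there is exactly one candidate and all its levels are digits in the base `levelBase
= 16 ^ 16`, which has room for 16 strands. -/
def splice (lo P H : ℕ) (M : List (List ℕ)) : Option ℕ :=
  List.rec none (fun m r _ => List.rec
    (bif anyRec (fun l => Nat.ble levelBase l) m then none
      else some (Nat.add lo (Nat.mul P (packOnto H m)))) (fun _ _ _ => none) r) M

/-- The lowest digits of `D` and `E` are the levels below and above the local diagram. The
candidates contain both, so only the digits of `E` after the first are put on top. -/
def spliceBetween (w : Diagram) (lo P D E : ℕ) : Option ℕ :=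
  splice lo P (Nat.div E levelBase)
    (Diagram.between w (Nat.mod D levelBase) (Nat.mod E levelBase))

def spliceAbove (w : Diagram) (n lo P D : ℕ) : Option ℕ :=
  spliceBetween w lo P D (Nat.div D (Nat.pow levelBase n))

def spliceAt (w : Diagram) (n P C : ℕ) : Option ℕ := spliceAbove w n (Nat.mod C P) P (Nat.div C P)

/-- The code of the coloring of the next still, if there is exactly one. -/
def Step.next (s : Step) (C : ℕ) : Option ℕ :=
  spliceAt s.tgt s.src.length (Nat.pow levelBase s.start) C

/-! ### Codes of whole colorings, and uniqueness of the continuation over one step. -/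

def packCode (c : List (List Label)) : ℕ := Nat.ofDigits levelBase (c.map levelCode)

def IsBounded (c : List (List Label)) : Prop := ∀ l ∈ c, levelCode l < levelBase

theorem levelBase_pos : 0 < levelBase := by decide

@[simp] theorem packCode_nil : packCode [] = 0 := rfl

@[simp] theorem packCode_cons (l : List Label) (c : List (List Label)) :
    packCode (l :: c) = levelCode l + levelBase * packCode c := by
  simp [packCode, Nat.ofDigits_cons]

theorem packCode_append (c d : List (List Label)) :
    packCode (c ++ d) = packCode c + levelBase ^ c.length * packCode d := by
  simp [packCode, Nat.ofDigits_append]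

theorem packOnto_eq (d c : List (List Label)) :
    packOnto (packCode d) (c.map levelCode) = packCode (c ++ d) := by
  induction c with
  | nil => rfl
  | cons l c ih => rw [List.cons_append, packCode_cons, ← ih]; rfl

theorem IsBounded.packCode_lt {c : List (List Label)} (h : IsBounded c) :
    packCode c < levelBase ^ c.length := by
  induction c with
  | nil => simp
  | cons l c ih =>
    have h1 := h l (by simp)
    have h2 := ih fun m hm => h m (by simp [hm])
    have h3 : levelBase * (packCode c + 1) ≤ levelBase * levelBase ^ c.length :=
      Nat.mul_le_mul_left _ h2
    rw [packCode_cons, List.length_cons, pow_succ']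
    rw [mul_add] at h3
    omega

theorem packCode_append_mod {c : List (List Label)} (h : IsBounded c) (d : List (List Label)) :
    packCode (c ++ d) % levelBase ^ c.length = packCode c := by
  rw [packCode_append, Nat.add_mul_mod_self_left, Nat.mod_eq_of_lt h.packCode_lt]

theorem packCode_append_div {c : List (List Label)} (h : IsBounded c) (d : List (List Label)) :
    packCode (c ++ d) / levelBase ^ c.length = packCode d := by
  rw [packCode_append, Nat.add_mul_div_left _ _ (Nat.pow_pos levelBase_pos),
    Nat.div_eq_of_lt h.packCode_lt, zero_add]

theorem packCode_cons_mod {l : List Label} (h : levelCode l < levelBase)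
    (c : List (List Label)) : packCode (l :: c) % levelBase = levelCode l := by
  rw [packCode_cons, Nat.add_mul_mod_self_left, Nat.mod_eq_of_lt h]

theorem packCode_cons_div {l : List Label} (h : levelCode l < levelBase)
    (c : List (List Label)) : packCode (l :: c) / levelBase = packCode c := by
  rw [packCode_cons, Nat.add_mul_div_left _ _ levelBase_pos, Nat.div_eq_of_lt h, zero_add]

/-- Equal lengths are required because an empty level has code 0, so empty levels at the end leave
no trace. -/
theorem IsBounded.eq_of_packCode_eq {c d : List (List Label)} (hc : IsBounded c)
    (hd : IsBounded d) (hl : c.length = d.length) (h : packCode c = packCode d) : c = d := by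
  induction c generalizing d with
  | nil => simp at hl; exact (List.length_eq_zero_iff.1 hl.symm).symm
  | cons l c ih =>
    obtain _ | ⟨m, d⟩ := d
    · simp at hl
    · have hl1 := hc l (by simp)
      have hm1 := hd m (by simp)
      have h1 := packCode_cons_mod hl1 c
      have h2 := packCode_cons_div hl1 c
      rw [h, packCode_cons_mod hm1] at h1
      rw [h, packCode_cons_div hm1] at h2
      rw [levelCode_injective h1, ih (fun x hx => hc x (by simp [hx]))
        (fun x hx => hd x (by simp [hx])) (by simpa using hl) h2.symm]

theorem splice_eq_some {lo P H C : ℕ} {M : List (List ℕ)} (h : splice lo P H M = some C) :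
    ∃ m, M = [m] ∧ (∀ l ∈ m, l < levelBase) ∧ C = lo + P * packOnto H m := by
  match M with
  | [] => cases h
  | [m] =>
    have h' : (bif anyRec (fun l => Nat.ble levelBase l) m then none
      else some (lo + P * packOnto H m)) = some C := h
    cases hb : anyRec (fun l => Nat.ble levelBase l) m with
    | true => simp [hb] at h'
    | false =>
      refine ⟨m, rfl, fun l hl => ?_, by simpa [hb] using h'.symm⟩
      have := anyRec_eq_false hb l hl
      rw [Bool.eq_false_iff, Ne, Nat.ble_eq] at this
      omega
  | _ :: _ :: _ => cases h

theorem Step.apply_eq_some {s : Step} {w v : Diagram} (h : s.apply w = some v) :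
    ∃ a b : Diagram, a.length = s.start ∧ w = a ++ s.src ++ b ∧ v = a ++ s.tgt ++ b := by
  unfold Step.apply at h
  split at h
  · rename_i hs
    refine ⟨w.take s.start, w.drop (s.start + s.src.length), by simpa using hs.2.1, ?_, ?_⟩
    · conv_lhs => rw [← List.take_append_drop s.start w,
        ← List.take_append_drop s.src.length (w.drop s.start), hs.2.2]
      simp
    · simpa using h.symm
  · simp at h

theorem Diagram.isColoring_append₃ (a t b : Diagram) (d : List (List Label)) :
    Diagram.IsColoring (a ++ t ++ b) d ↔ Diagram.IsColoring a (d.take (a.length + 1)) ∧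
      Diagram.IsColoring t ((d.drop a.length).take (t.length + 1)) ∧
        Diagram.IsColoring b (d.drop (a.length + t.length)) := by
  rw [List.append_assoc, Diagram.isColoring_append, Diagram.isColoring_append, List.drop_drop]

/-- The step has exactly one continuation. -/
theorem Step.next_spec {s : Step} {w v : Diagram} {c : List (List Label)} {C : ℕ}
    (hw : Diagram.IsColoring w c) (hc : IsBounded c) (hv : s.apply w = some v)
    (h : s.next (packCode c) = some C) :
    ∃ c', C = packCode c' ∧ IsBounded c' ∧
      ∀ d, (Diagram.IsColoring v d ∧ s.Agree c d) ↔ d = c' := by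
  obtain ⟨a, b, ha, rfl, rfl⟩ := Step.apply_eq_some hv
  have hlen := hw.length
  simp only [List.length_append] at hlen
  obtain ⟨hwa, -, hwb⟩ := (Diagram.isColoring_append₃ _ _ _ _).1 hw
  obtain ⟨c₁, D, hc₁, rfl⟩ : ∃ c₁ D, c₁.length = s.start ∧ c = c₁ ++ D :=
    ⟨c.take s.start, c.drop s.start, by rw [List.length_take]; omega, by simp⟩
  obtain ⟨m₀, E, hm₀, rfl⟩ : ∃ m₀ E, m₀.length = s.src.length ∧ D = m₀ ++ E :=
    ⟨D.take s.src.length, D.drop s.src.length,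
      by simp at hlen; rw [List.length_take]; omega, by simp⟩
  obtain ⟨l₁, H, rfl⟩ : ∃ l₁ H, E = l₁ :: H := by
    apply List.exists_cons_of_ne_nil
    rintro rfl
    simp at hlen; omega
  -- The level `l₀` below the local diagram coincides with the level `l₁` above it if `s.src` is
  -- empty, so it cannot be split off from `m₀`.
  obtain ⟨l₀, m₁, hlm⟩ : ∃ l₀ m₁, m₀ ++ l₁ :: H = l₀ :: m₁ :=
    List.exists_cons_of_ne_nil (by simp)
  have hb₁ : IsBounded c₁ := fun l hl => hc l (by simp [hl])
  have hb₀ : IsBounded m₀ := fun l hl => hc l (by simp [hl])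
  have hbH : IsBounded H := fun l hl => hc l (by simp [hl])
  have hl₁ : levelCode l₁ < levelBase := hc l₁ (by simp)
  have hl₀ : levelCode l₀ < levelBase := hc l₀ (by rw [hlm]; simp)
  have e : s.next (packCode (c₁ ++ (m₀ ++ l₁ :: H))) =
      splice (packCode c₁) (levelBase ^ s.start) (packCode H)
        (Diagram.between s.tgt (levelCode l₀) (levelCode l₁)) := by
    have e1 := packCode_append_mod hb₁ (m₀ ++ l₁ :: H)
    have e2 := packCode_append_div hb₁ (m₀ ++ l₁ :: H)
    have e3 := packCode_append_div hb₀ (l₁ :: H)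
    have e4 := packCode_cons_mod hl₀ m₁
    rw [hc₁] at e1 e2
    rw [hm₀] at e3
    rw [← hlm] at e4
    rw [← e1, ← packCode_cons_div hl₁ H, ← packCode_cons_mod hl₁ H, ← e4, ← e3, ← e2]
    rfl
  rw [e] at h
  obtain ⟨m, hM, hlt, rfl⟩ := splice_eq_some h
  have hmem : ∀ m', m' ∈ Diagram.between s.tgt (levelCode l₀) (levelCode l₁) ↔ m' = m := by
    simp [hM]
  obtain ⟨mid, rfl, hmid, hmid₀, hmid₁⟩ := (Diagram.mem_between _ _ _ _).1 ((hmem m).2 rfl)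
  have hml := hmid.length
  obtain ⟨mid₀, rfl⟩ : ∃ mid₀, mid = l₀ :: mid₀ := by
    obtain _ | ⟨x, mid₀⟩ := mid
    · simp at hmid₀
    · exact ⟨mid₀, by simpa using hmid₀⟩
  -- Both forms of the new local coloring are needed: its first level is shared with the part below,
  -- its last with the part above.
  obtain ⟨mid₁, hmid₂⟩ : ∃ mid₁, l₀ :: mid₀ = mid₁ ++ [l₁] := by
    exact List.getLast?_eq_some_iff.1 hmid₁
  have hml₁ : mid₁.length = s.tgt.length := by
    have := congrArg List.length hmid₂
    simp at this hml
    omega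
  refine ⟨c₁ ++ (l₀ :: mid₀ ++ H), ?_, ?_, fun d => ?_⟩
  · rw [packOnto_eq, packCode_append c₁, hc₁]
  · intro l hl
    simp only [List.mem_append] at hl
    rcases hl with hl | hl | hl
    · exact hb₁ l hl
    · exact hlt _ (List.mem_map_of_mem hl)
    · exact hbH l hl
  · have hct : (c₁ ++ (m₀ ++ l₁ :: H)).take (s.start + 1) = c₁ ++ [l₀] := by
      rw [hlm, ← hc₁, List.take_length_add_append]; simp
    have hcd : (c₁ ++ (m₀ ++ l₁ :: H)).drop (s.start + s.src.length) = l₁ :: H := by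
      rw [← List.append_assoc, List.drop_left' (by simp [hc₁, hm₀])]
    rw [ha] at hwa hwb
    rw [hct] at hwa
    rw [hcd] at hwb
    rw [Diagram.isColoring_append₃, Step.Agree, hct, hcd, ha]
    constructor
    · rintro ⟨⟨-, hd, -⟩, h1, h2⟩
      have hdl := congrArg List.length h2
      rw [List.length_drop, List.length_cons] at hdl
      have hd1 : d.take s.start = c₁ := by
        have := congrArg (List.take s.start) h1
        rw [List.take_take, min_eq_left (by omega), List.take_left' hc₁] at this
        exact this.symm
      have hd2 : d = c₁ ++ d.drop s.start := by rw [← hd1, List.take_append_drop]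
      have hd3 : (d.drop s.start).drop s.tgt.length = l₁ :: H := by
        rw [List.drop_drop, ← h2.symm]
      have hd4 : d.drop s.start = (d.drop s.start).take s.tgt.length ++ l₁ :: H := by
        rw [← hd3, List.take_append_drop]
      have hd5 : (d.drop s.start).take (s.tgt.length + 1) =
          (d.drop s.start).take s.tgt.length ++ [l₁] := by
        rw [List.take_add, hd3]; rfl
      have hd6 : (d.drop s.start).head? = some l₀ := by
        have := congrArg (List.drop s.start) h1
        rw [List.drop_left' hc₁, List.drop_take, Nat.add_sub_cancel_left] at this
        cases hx : d.drop s.start with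
        | nil => simp [hx] at this
        | cons y t => rw [hx] at this; simpa using this.symm
      -- By `Step.Agree`, the local part of `d` is a coloring of `s.tgt` from `l₀` to `l₁`; it is
      -- therefore the only candidate.
      have key := (hmem _).1 ((Diagram.mem_between s.tgt l₀ l₁ _).2 ⟨_, rfl, hd, by
        rw [List.head?_take, if_neg (by omega), hd6], by rw [hd5]; simp⟩)
      have key' := List.map_injective_iff.2 levelCode_injective key
      rw [hd5, hmid₂] at key'
      have key₂ := List.append_cancel_right key'
      rw [hd2, hd4, key₂, hmid₂]
      simp
    · rintro rfl
      have h1 : (c₁ ++ (l₀ :: mid₀ ++ H)).take (s.start + 1) = c₁ ++ [l₀] := by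
        rw [← hc₁, List.take_length_add_append]; simp
      have h2 : (c₁ ++ (l₀ :: mid₀ ++ H)).drop (s.start + s.tgt.length) = l₁ :: H := by
        rw [hmid₂, List.append_assoc, ← List.append_assoc, List.drop_left' (by simp [hc₁, hml₁])]
        rfl
      refine ⟨⟨by rw [h1]; exact hwa, ?_, by rw [h2]; exact hwb⟩, h1.symm, h2.symm⟩
      rw [List.drop_left' hc₁, List.take_left' (by simpa using hml)]
      exact hmid

/-! ## Values, and movies -/

/-- The label that `labelAt` finds in the coloring with the code `C`. -/
def codeLabelAt (C n i : ℕ) : Label :=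
  Label.decode (Nat.mod (Nat.div (Nat.mod (Nat.div C (Nat.pow levelBase n)) levelBase)
    (Nat.pow 16 i)) 16)

/-- `r3Label`, for labels that are given by functions. -/
def r3LabelOf (f f' : ℕ → ℕ → Label) (n i : ℕ) : Fin 3 → Bool → Bool → Label
  | 0, false, false => f n i
  | 0, true, false => f (n + 1) (i + 1)
  | 0, false, true => f' (n + 2) (i + 1)
  | 0, true, true => f (n + 3) (i + 2)
  | 1, false, false => f n (i + 1)
  | 1, true, false => f (n + 1) i
  | 1, false, true => f' (n + 1) (i + 2)
  | 1, true, true => f (n + 3) (i + 1)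
  | 2, false, false => f n (i + 2)
  | 2, true, false => f (n + 2) (i + 1)
  | 2, false, true => f' (n + 1) (i + 1)
  | 2, true, true => f (n + 3) i

/-- `r3Source`, for labels that are given by functions. -/
def r3SourceOf (f f' : ℕ → ℕ → Label) (n i : ℕ) (up : Fin 3 → Bool) (s : Fin 3) : Label :=
  let above (u : Fin 3) : Bool := decide (s < u) != up u
  match s with
  | 0 => r3LabelOf f f' n i 0 (above 1) (above 2)
  | 1 => r3LabelOf f f' n i 1 (above 0) (above 2)
  | 2 => r3LabelOf f f' n i 2 (above 0) (above 1)

/-- `tripleValue`, for labels that are given by functions. -/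
def tripleValueOf (f f' : ℕ → ℕ → Label) (n : ℕ) (ab ac bc : Bool) (i : ℕ) : ZMod 3 :=
  let up (s : Fin 3) : Bool := (r3LabelOf f f' n i s false false).up
  let sg (s : Fin 3) : ZMod 3 := if up s then 1 else -1
  let o := r3Order ab ac bc
  orderSign o * sg 0 * sg 1 * sg 2 *
    theta (r3SourceOf f f' n i up o.2.2).color (r3SourceOf f f' n i up o.2.1).color
      (r3SourceOf f f' n i up o.1).color

/-- `Step.value`, for labels that are given by functions. -/
def Step.valueOf (s : Step) (f f' : ℕ → ℕ → Label) : ZMod 3 :=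
  match s.move with
  | .r3 ab ac bc i =>
    if s.fwd then tripleValueOf f f' s.start ab ac bc i
    else -tripleValueOf f' f s.start ab ac bc i
  | _ => 0

theorem r3Label_eq (c c' : List (List Label)) (n i : ℕ) :
    r3Label c c' n i = r3LabelOf (labelAt c) (labelAt c') n i := by
  funext s x y
  fin_cases s <;> cases x <;> cases y <;> rfl

theorem r3Source_eq (c c' : List (List Label)) (n i : ℕ) :
    r3Source c c' n i = r3SourceOf (labelAt c) (labelAt c') n i := by
  funext up s
  fin_cases s <;> simp only [r3Source, r3SourceOf, r3Label_eq]

theorem tripleValue_eq (c c' : List (List Label)) (n : ℕ) (ab ac bc : Bool) (i : ℕ) :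
    tripleValue c c' n ab ac bc i = tripleValueOf (labelAt c) (labelAt c') n ab ac bc i := by
  simp only [tripleValue, tripleValueOf, r3Label_eq, r3Source_eq]

theorem Step.value_eq (s : Step) (c c' : List (List Label)) :
    s.value c c' = s.valueOf (labelAt c) (labelAt c') := by
  unfold Step.value Step.valueOf
  cases s.move <;> simp only [tripleValue_eq]

/-- Positions beyond the last strand give the digit 0, which decodes to the default label that
`labelAt` uses. -/
theorem levelCode_digit (l : List Label) (i : ℕ) :
    Label.decode (levelCode l / 16 ^ i % 16) = l.getD i default := by
  induction l generalizing i with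
  | nil => simp [Label.decode_zero]
  | cons x l ih =>
    cases i with
    | zero => rw [pow_zero, Nat.div_one, levelCode_mod_cons, Label.decode_code]; rfl
    | succ i => rw [pow_succ', ← Nat.div_div_eq_div_mul, levelCode_div_cons, ih]; rfl

theorem IsBounded.packCode_digit {c : List (List Label)} (hc : IsBounded c) (n : ℕ) :
    packCode c / levelBase ^ n % levelBase = levelCode (c.getD n []) := by
  induction c generalizing n with
  | nil => simp
  | cons l c ih =>
    have hl := hc l (by simp)
    cases n with
    | zero => rw [pow_zero, Nat.div_one, packCode_cons_mod hl]; rfl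
    | succ n =>
      rw [pow_succ', ← Nat.div_div_eq_div_mul, packCode_cons_div hl,
        ih (fun m hm => hc m (by simp [hm]))]
      rfl

theorem IsBounded.codeLabelAt {c : List (List Label)} (hc : IsBounded c) :
    codeLabelAt (packCode c) = labelAt c := by
  funext n i
  rw [labelAt, ← levelCode_digit, ← hc.packCode_digit]
  rfl

def Move.isR3 : Move → Bool
  | .r3 .. => true
  | _ => false

/-- The sum of `u` and the value of a step between the colorings with the codes `C`, `C'`. -/
def Step.addValue (s : Step) (u : ZMod 3) (C C' : ℕ) : ZMod 3 :=
  bif s.move.isR3 then u + s.valueOf (codeLabelAt C) (codeLabelAt C') else u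

theorem Step.addValue_eq (s : Step) (u : ZMod 3) (C C' : ℕ) :
    s.addValue u C C' = u + s.valueOf (codeLabelAt C) (codeLabelAt C') := by
  unfold Step.addValue Step.valueOf
  cases s.move <;> simp [Move.isR3]

/-- Continues the coloring with the code `C` of the first still to the whole movie, as long as
there is exactly one way to do so.  Computes the code of the coloring of the last still, and the sum
of `u` and the value. -/
def movieRun (ss : List Step) : ℕ → ZMod 3 → Option (ℕ × ZMod 3) :=
  List.rec (fun C u => some (C, u))
    (fun s _ ih C u => Option.rec none (fun C' => force C' fun C' =>
      ih C' (s.addValue u C C')) (s.next C)) ss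

theorem movieRun_nil (C : ℕ) (u : ZMod 3) : movieRun [] C u = some (C, u) := rfl

theorem movieRun_cons (s : Step) (ss : List Step) (C : ℕ) (u : ZMod 3) :
    movieRun (s :: ss) C u = (s.next C).bind fun C' =>
      movieRun ss C' (u + s.valueOf (codeLabelAt C) (codeLabelAt C')) := by
  change (Option.rec none (fun C' => force C' fun C' =>
    movieRun ss C' (s.addValue u C C')) (s.next C) :
      Option (ℕ × ZMod 3)) = _
  cases s.next C with
  | none => rfl
  | some C' => simp only [force_eq, Option.bind_some, Step.addValue_eq]

theorem movieRun_append (a b : List Step) (C : ℕ) (u : ZMod 3) :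
    movieRun (a ++ b) C u = (movieRun a C u).bind fun p => movieRun b p.1 p.2 := by
  induction a generalizing C u with
  | nil => rfl
  | cons s a ih =>
    rw [List.cons_append, movieRun_cons, movieRun_cons]
    cases s.next C with
    | none => rfl
    | some C' => simp [ih]

/-- The accumulated value never influences the coloring. Hence the value of the second twist can be
computed from 0 and added afterwards. -/
theorem movieRun_add (a : List Step) (C : ℕ) (u v : ZMod 3) :
    movieRun a C (u + v) = (movieRun a C v).map fun p => (p.1, u + p.2) := by
  induction a generalizing C v with
  | nil => rfl
  | cons s a ih =>
    rw [movieRun_cons, movieRun_cons]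
    cases s.next C with
    | none => rfl
    | some C' => simp [← ih, add_assoc]

/-- A successful run certifies one-step uniqueness at every still, through `Step.next_spec`; by
induction the coloring of the first still determines that of the movie. -/
theorem movieRun_spec {ss : List Step} {w z : Diagram} {c : List (List Label)} {C' : ℕ}
    {u u' : ZMod 3} (hw : Diagram.IsColoring w c) (hc : IsBounded c) (hr : run w ss = some z)
    (h : movieRun ss (packCode c) u = some (C', u')) :
    ∃ C c', IsMovieColoring w ss C ∧ C.head? = some c ∧ C.getLast? = some c' ∧
      C' = packCode c' ∧ IsBounded c' ∧ Diagram.IsColoring z c' ∧ u' = u + movieValue ss C ∧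
      ∀ D, IsMovieColoring w ss D → D.head? = some c → D = C := by
  induction ss generalizing w c u with
  | nil =>
    obtain rfl : w = z := by
      simp only [run] at hr
      split at hr <;> simp_all
    rw [movieRun_nil] at h
    obtain ⟨rfl, rfl⟩ : packCode c = C' ∧ u = u' := by simpa using h
    refine ⟨[c], c, hw, rfl, rfl, rfl, hc, hw, by simp [movieValue], fun D hD hD' => ?_⟩
    match D, hD with
    | [d], _ => simpa using hD'
  | cons s ss ih =>
    obtain ⟨v, hv, hrv⟩ : ∃ v, s.apply w = some v ∧ run v ss = some z := by
      simp only [run] at hr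
      split at hr
      · simpa [Option.bind_eq_some_iff] using hr
      · simp at hr
    rw [movieRun_cons] at h
    cases hs : s.next (packCode c) with
    | none => simp [hs] at h
    | some C₁ =>
      obtain ⟨c₁, rfl, hc₁, hd⟩ := Step.next_spec hw hc hv hs
      obtain ⟨hw₁, hag⟩ := (hd c₁).2 rfl
      rw [hs, Option.bind_some, hc.codeLabelAt, hc₁.codeLabelAt, ← Step.value_eq] at h
      obtain ⟨C, c', hC, hC₀, hC₁, rfl, hc', hz, rfl, huniq⟩ := ih hw₁ hc₁ hrv h
      obtain ⟨C₂, rfl⟩ : ∃ C₂, C = c₁ :: C₂ := by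
        obtain _ | ⟨x, C₂⟩ := C
        · simp at hC₀
        · exact ⟨C₂, by simpa using hC₀⟩
      refine ⟨c :: c₁ :: C₂, c', ⟨hw, hag, v, hv, hC⟩, rfl, ?_, rfl, hc', hz, ?_, ?_⟩
      · rw [List.getLast?_cons, hC₁]; rfl
      · simp [movieValue, add_assoc]
      · intro D hD hD₀
        match D, hD with
        | d :: d' :: D, ⟨_, hda, v', hv', hD'⟩ =>
          obtain rfl : d = c := by simpa using hD₀
          obtain rfl : v' = v := by rw [hv] at hv'; exact (Option.some.inj hv').symm
          have hdv : Diagram.IsColoring v' d' := by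
            match ss, D, hD' with
            | [], [], h => exact h
            | _ :: _, _ :: _, h => exact h.1
          obtain rfl := (hd d').1 ⟨hdv, hda⟩
          rw [huniq (d' :: D) hD' rfl]

/-! ## Colorings of twist-spins -/

/-- The codes of the colorings of `T` whose lowest level consists of one strand, with the same
orientation as the first strand of the highest level. -/
def initials (T : Diagram) : List (List ℕ) :=
  -- The codes up to 6 are those of the upward labels.
  flatMapRec (fun x => Diagram.extend (fun y => Nat.ble x 6 == Nat.ble (Nat.mod y 16) 6) T x)
    [1, 2, 3, 4, 5, 6, 7, 8, 9, 10, 11, 12]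

theorem Label.code_mem (x : Label) : x.code ∈ [1, 2, 3, 4, 5, 6, 7, 8, 9, 10, 11, 12] := by
  revert x; decide +kernel

theorem Label.exists_code_eq {n : ℕ} (h : n ∈ [1, 2, 3, 4, 5, 6, 7, 8, 9, 10, 11, 12]) :
    ∃ x : Label, x.code = n := by
  revert n; decide +kernel

theorem Label.ble_code (x : Label) : Nat.ble x.code 6 = x.up := by
  conv_rhs => rw [← Label.decode_code x]
  rfl

theorem ble_levelCode (l : List Label) :
    Nat.ble (Nat.mod (levelCode l) 16) 6 = (l.getD 0 default).up := by
  rw [← levelCode_digit, pow_zero, Nat.div_one]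
  rfl

theorem mem_initials (T : Diagram) (m : List ℕ) :
    m ∈ initials T ↔ ∃ c, m = c.map levelCode ∧ Diagram.IsColoring T c ∧
      (c.getD 0 []).length = 1 ∧ (labelAt c 0 0).up = (labelAt c T.length 0).up := by
  simp only [initials, flatMapRec_eq, List.mem_flatMap]
  have key : ∀ (x : Label), x.code = levelCode [x] := by simp
  have hlast : ∀ (c : List (List Label)) (l' : List Label), Diagram.IsColoring T c →
      c.getLast? = some l' → labelAt c T.length 0 = l'.getD 0 default := by
    intro c l' hc hl'
    rw [labelAt, List.getD_eq_getElem?_getD (l := c)]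
    rw [List.getLast?_eq_getElem?, hc.length, Nat.add_sub_cancel] at hl'
    rw [hl']; rfl
  constructor
  · rintro ⟨_, hx, hm⟩
    obtain ⟨x, rfl⟩ := Label.exists_code_eq hx
    rw [Label.ble_code] at hm
    rw [key, Diagram.mem_extend] at hm
    obtain ⟨c, rfl, hc, hl, l', hl', hp⟩ := hm
    refine ⟨c, rfl, hc, ?_, ?_⟩
    · cases c with
      | nil => simp at hl
      | cons l c => obtain rfl : l = [x] := by simpa using hl
                    rfl
    · rw [hlast c l' hc hl', ← ble_levelCode, ← beq_iff_eq.1 hp]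
      cases c with
      | nil => simp at hl
      | cons l c => obtain rfl : l = [x] := by simpa using hl
                    rfl
  · rintro ⟨c, rfl, hc, hl, hup⟩
    obtain _ | ⟨l, c⟩ := c
    · simp at hl
    obtain ⟨x, rfl⟩ := List.length_eq_one_iff.1 (show l.length = 1 from hl)
    refine ⟨x.code, Label.code_mem x, ?_⟩
    rw [Label.ble_code, key, Diagram.mem_extend]
    obtain ⟨l', hl'⟩ : ∃ l', ([x] :: c).getLast? = some l' :=
      ⟨_, List.getLast?_eq_some_getLast (by simp)⟩
    refine ⟨_, rfl, hc, rfl, l', hl', ?_⟩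
    rw [hlast _ l' hc hl'] at hup
    rw [ble_levelCode, ← hup]
    simp [labelAt]

/-! ### Double twists -/

/-- Passes to `k` the table of the results of `movieRun ss n 0`, for the numbers `n` of a list. -/
def tabulate (ss : List Step) (l : List ℕ) : (List (ℕ × ℕ × ℕ) → Bool) → Bool :=
  List.rec (fun k => k []) (fun n _ ih k => force n fun n =>
    Option.rec false (fun p => force p.1 fun n' => force (ZMod.val p.2) fun v =>
      ih fun t => k ((n, n', v) :: t)) (movieRun ss n 0)) l

def lookup (t : List (ℕ × ℕ × ℕ)) (n : ℕ) (k : ℕ → ℕ → Bool) : Bool :=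
  List.rec false (fun r _ ih => bif Nat.beq r.1 n then k r.2.1 r.2.2 else ih) t

/-- Passes to `k` the values of two successive runs, provided that the second one returns to the
beginning of the first one. -/
def totals (t rows : List (ℕ × ℕ × ℕ)) : (List ℕ → Bool) → Bool :=
  List.rec (fun k => k []) (fun r _ ih k => lookup t r.2.1 fun n v =>
    bif Nat.beq n r.1 then force (Nat.mod (Nat.add r.2.2 v) 3) fun v => ih fun l => k (v :: l)
    else false) rows

def nodupRec (l : List ℕ) : Bool :=
  List.rec true (fun n r ih => bif anyRec (Nat.beq n) r then false else ih) l

/-- Checks that the boundaries of all the digits are respected, that each initial coloring has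
exactly one continuation along two full twists, which returns to it, and that the values satisfy
`p`. -/
def checkDoubleTwist (T : Diagram) (p : List ℕ → Bool) : Bool :=
  bif anyRec (anyRec fun l => Nat.ble levelBase l) (initials T) then false
  else tabulate (fullTwist T) (mapRec (packOnto 0) (initials T)) fun t => totals t t fun l =>
    bif nodupRec (mapRec Prod.fst t) then p l else false

theorem tabulate_spec {ss : List Step} {l : List ℕ} {k : List (ℕ × ℕ × ℕ) → Bool}
    (h : tabulate ss l k = true) :
    ∃ t, t.map Prod.fst = l ∧ (∀ r ∈ t, movieRun ss r.1 0 = some (r.2.1, (r.2.2 : ZMod 3))) ∧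
      k t = true := by
  induction l generalizing k with
  | nil => exact ⟨[], rfl, by simp, h⟩
  | cons n l ih =>
    change (force n fun n => (Option.rec false (fun p => force p.1 fun n' =>
      force (ZMod.val p.2) fun v => tabulate ss l fun t => k ((n, n', v) :: t))
        (movieRun ss n 0) : Bool)) = true at h
    simp only [force_eq] at h
    cases hn : movieRun ss n 0 with
    | none => simp [hn] at h
    | some p =>
      rw [hn] at h
      obtain ⟨t, rfl, ht, hk⟩ := ih h
      refine ⟨_, rfl, ?_, hk⟩
      rintro r (_ | ⟨_, hr⟩)
      · simp [hn]
      · exact ht r hr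

theorem lookup_spec {t : List (ℕ × ℕ × ℕ)} {n : ℕ} {k : ℕ → ℕ → Bool}
    (h : lookup t n k = true) : ∃ r ∈ t, r.1 = n ∧ k r.2.1 r.2.2 = true := by
  induction t with
  | nil => cases h
  | cons r t ih =>
    have h' : (bif Nat.beq r.1 n then k r.2.1 r.2.2 else lookup t n k) = true := h
    cases hb : Nat.beq r.1 n with
    | true => exact ⟨r, by simp, Nat.eq_of_beq_eq_true hb, by simpa [hb] using h'⟩
    | false =>
      rw [hb] at h'
      obtain ⟨r', hr', h1, h2⟩ := ih h'
      exact ⟨r', by simp [hr'], h1, h2⟩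

/-- In the induction `rows` shrinks while the table `t` stays whole. The predicate `Q` carries along
what is known about each row. -/
theorem totals_spec {t rows : List (ℕ × ℕ × ℕ)} {k : List ℕ → Bool} {Q : ℕ × ℕ × ℕ → Prop}
    (h : totals t rows k = true) (hQ : ∀ r ∈ rows, Q r) :
    ∃ L : List ℕ, List.Forall₂ (fun (r : ℕ × ℕ × ℕ) (v : ℕ) => Q r ∧ ∃ r' ∈ t, r'.1 = r.2.1 ∧ r'.2.1 = r.1 ∧
      (v : ZMod 3) = r.2.2 + r'.2.2) rows L ∧ k L = true := by
  induction rows generalizing k with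
  | nil => exact ⟨[], .nil, h⟩
  | cons r rows ih =>
    obtain ⟨r', hr', h1, h2⟩ := lookup_spec (k := fun n v => bif Nat.beq n r.1 then
      force (Nat.mod (Nat.add r.2.2 v) 3) fun v => totals t rows fun l => k (v :: l)
      else false) h
    cases hb : Nat.beq r'.2.1 r.1 with
    | false => simp [hb] at h2
    | true =>
      simp only [hb, cond_true, force_eq] at h2
      obtain ⟨L, hL, hk⟩ := ih h2 fun r hr => hQ r (by simp [hr])
      refine ⟨_, .cons ⟨hQ r (by simp), r', hr', h1, Nat.eq_of_beq_eq_true hb, ?_⟩ hL, hk⟩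
      change (((r.2.2 + r'.2.2) % 3 : ℕ) : ZMod 3) = _
      rw [ZMod.natCast_mod, Nat.cast_add]

theorem nodupRec_spec {l : List ℕ} (h : nodupRec l = true) : l.Nodup := by
  induction l with
  | nil => simp
  | cons n l ih =>
    have h' : (bif anyRec (Nat.beq n) l then false else nodupRec l) = true := h
    cases hb : anyRec (Nat.beq n) l with
    | true => simp [hb] at h'
    | false =>
      refine List.nodup_cons.2 ⟨fun hn => ?_, ih (by simpa [hb] using h')⟩
      have := anyRec_eq_false hb n hn
      simp at this

/-- Each initial coloring is run through one full twist only. The second twist starts at another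
coloring of the table, so its result is looked up, and `movieRun_append` and `movieRun_add` join the
two runs. -/
theorem checkDoubleTwist_spec {T : Diagram} {p : List ℕ → Bool}
    (h : checkDoubleTwist T p = true) :
    (∀ m ∈ initials T, ∀ l ∈ m, l < levelBase) ∧ ((initials T).map (packOnto 0)).Nodup ∧
      ∃ L : List ℕ, List.Forall₂ (fun (n v : ℕ) => movieRun (fullTwist T ++ fullTwist T) n 0 =
        some (n, (v : ZMod 3))) ((initials T).map (packOnto 0)) L ∧ p L = true := by
  unfold checkDoubleTwist at h
  cases hb : anyRec (anyRec fun l => Nat.ble levelBase l) (initials T) with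
  | true => simp [hb] at h
  | false =>
    rw [hb, cond_false, mapRec_eq] at h
    obtain ⟨t, ht, hrun, h⟩ := tabulate_spec h
    obtain ⟨L, hL, h⟩ := totals_spec h hrun
    rw [mapRec_eq, ht] at h
    cases hn : nodupRec ((initials T).map (packOnto 0)) with
    | false => simp [hn] at h
    | true =>
      refine ⟨fun m hm l hl => ?_, nodupRec_spec hn, L, ?_, by simpa [hn] using h⟩
      · have := anyRec_eq_false (anyRec_eq_false hb m hm) l hl
        rw [Bool.eq_false_iff, Ne, Nat.ble_eq] at this
        omega
      · rw [← ht, List.forall₂_map_left_iff]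
        refine hL.imp fun r v ⟨hr, r', hr', h1, h2, hv⟩ => ?_
        rw [movieRun_append, hr, Option.bind_some, ← h1]
        have := movieRun_add (fullTwist T) r'.1 (r.2.2 : ZMod 3) 0
        rw [add_zero, hrun r' hr'] at this
        rw [this, hv, ← h2]
        rfl

/-! ### From colorings of the first still to colorings of the foam. -/

theorem Foam.Coloring.exists_head {F : Foam} (X : F.Coloring) :
    ∃ c, X.1.head? = some c ∧ Diagram.IsColoring F.still c ∧ (c.getD 0 []).length = 1 ∧
      (labelAt c 0 0).up = (labelAt c F.still.length 0).up := by
  obtain ⟨C, hC, -, hends⟩ := X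
  have : ∃ c, C.head? = some c ∧ Diagram.IsColoring F.still c := by
    generalize F.steps = ss at hC
    match ss, C, hC with
    | [], [c], h => exact ⟨c, rfl, h⟩
    | _ :: _, c :: _ :: _, h => exact ⟨c, rfl, h.1⟩
  obtain ⟨c, hc, hcol⟩ := this
  exact ⟨c, hc, hcol, hends c hc⟩

/-- A foam is colored by the colorings of its first still, if each of them has exactly one
continuation, and if this returns to the first still. -/
theorem Foam.cocycleInvariant_eq {F : Foam} {P : List ℕ} {val : ℕ → ZMod 3} (hnd : P.Nodup)
    (hrun : ∀ n ∈ P, movieRun F.steps n 0 = some (n, val n))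
    (hmem : ∀ n, n ∈ P ↔ ∃ c, n = packCode c ∧ Diagram.IsColoring F.still c ∧
      (c.getD 0 []).length = 1 ∧ (labelAt c 0 0).up = (labelAt c F.still.length 0).up)
    (hbounded : ∀ c, Diagram.IsColoring F.still c → (c.getD 0 []).length = 1 →
      (labelAt c 0 0).up = (labelAt c F.still.length 0).up → IsBounded c) :
    F.cocycleInvariant = (P.map val : Multiset (ZMod 3)) := by
  -- Every admissible coloring of the first still is the beginning of exactly one coloring of the
  -- foam: the run extends it uniquely, and it returns because the final code equals the initial
  -- one.
  have main : ∀ c, Diagram.IsColoring F.still c → (c.getD 0 []).length = 1 →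
      (labelAt c 0 0).up = (labelAt c F.still.length 0).up →
        ∃ X : F.Coloring, X.1.head? = some c ∧ X.value = val (packCode c) ∧
          ∀ Y : F.Coloring, Y.1.head? = some c → Y = X := by
    intro c h1 h2 h3
    have hb := hbounded c h1 h2 h3
    obtain ⟨C, c', hC, hC₀, hC₁, e, hc', hz, hv, huniq⟩ :=
      movieRun_spec h1 hb F.closed (hrun _ ((hmem _).2 ⟨c, rfl, h1, h2, h3⟩))
    obtain rfl : c = c' := hb.eq_of_packCode_eq hc' (h1.length.trans hz.length.symm) e
    refine ⟨⟨C, hC, hC₀.trans hC₁.symm, fun d hd => ?_⟩, hC₀, by rw [hv, zero_add]; rfl,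
      fun Y hY => Subtype.ext (huniq _ Y.2.1 hY)⟩
    obtain rfl : c = d := by
      rw [hC₀] at hd
      exact Option.some.inj hd
    exact ⟨h2, h3⟩
  choose head hhead using fun X : F.Coloring => X.exists_head
  -- Restriction to the first still, as a map to codes. Its bijectivity turns the `finsum` over all
  -- colorings into a finite sum over `P`.
  let key : F.Coloring → {n // n ∈ P.toFinset} := fun X =>
    ⟨packCode (head X), by
      rw [List.mem_toFinset, hmem]
      exact ⟨_, rfl, (hhead X).2⟩⟩
  have hinj : Function.Injective key := by
    intro X Y hXY
    obtain ⟨hX, hX1, hX2, hX3⟩ := hhead X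
    obtain ⟨hY, hY1, hY2, hY3⟩ := hhead Y
    have e : head X = head Y := (hbounded _ hX1 hX2 hX3).eq_of_packCode_eq
      (hbounded _ hY1 hY2 hY3) (hX1.length.trans hY1.length.symm) (congrArg Subtype.val hXY)
    obtain ⟨Z, -, -, hZ⟩ := main _ hX1 hX2 hX3
    rw [hZ X hX, hZ Y (hY.trans (congrArg some e.symm))]
  have hsurj : Function.Surjective key := by
    rintro ⟨n, hn⟩
    obtain ⟨c, rfl, h1, h2, h3⟩ := (hmem n).1 (List.mem_toFinset.1 hn)
    obtain ⟨X, hX, -, -⟩ := main c h1 h2 h3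
    refine ⟨X, Subtype.ext ?_⟩
    have := (hhead X).1.symm.trans hX
    exact congrArg packCode (Option.some.inj this)
  have hvalue : ∀ X : F.Coloring, ({X.value} : Multiset (ZMod 3)) = {val (key X).1} := by
    intro X
    obtain ⟨hX, hX1, hX2, hX3⟩ := hhead X
    obtain ⟨Z, -, hZv, hZ⟩ := main _ hX1 hX2 hX3
    have e : X.value = val (packCode (head X)) :=
      (congrArg Foam.Coloring.value (hZ X hX)).trans hZv
    rw [e]
  rw [Foam.cocycleInvariant, finsum_eq_of_bijective key ⟨hinj, hsurj⟩
    (g := fun n => ({val n.1} : Multiset (ZMod 3))) hvalue, finsum_eq_sum_of_fintype,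
    Finset.sum_coe_sort P.toFinset fun n => ({val n} : Multiset (ZMod 3)),
    List.sum_toFinset _ hnd]
  clear * -
  induction P with
  | nil => rfl
  | cons n P ih => rw [List.map_cons, List.sum_cons, ih]; rfl

theorem cocycleInvariant_twistSpin_two {T : Diagram} {p : List ℕ → Bool}
    (h : checkDoubleTwist T p = true) :
    ∃ L : List ℕ, p L = true ∧ ∀ hT : run T (fullTwist T) = some T,
      (twistSpin T 2 hT).cocycleInvariant =
        (L.map (fun v : ℕ => (v : ZMod 3)) : Multiset (ZMod 3)) := by
  obtain ⟨hbd, hnd, L, hL, hp⟩ := checkDoubleTwist_spec h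
  refine ⟨L, hp, fun hT => ?_⟩
  let val : ℕ → ZMod 3 := fun n =>
    ((movieRun (fullTwist T ++ fullTwist T) n 0).map Prod.snd).getD 0
  have hsteps : (twistSpin T 2 hT).steps = fullTwist T ++ fullTwist T := by
    simp [twistSpin, List.replicate_succ]
  have hL' : ∀ {P L : List ℕ}, List.Forall₂ (fun (n v : ℕ) =>
      movieRun (fullTwist T ++ fullTwist T) n 0 = some (n, (v : ZMod 3))) P L →
      P.map val = L.map (fun v : ℕ => (v : ZMod 3)) ∧
        ∀ n ∈ P, movieRun (fullTwist T ++ fullTwist T) n 0 = some (n, val n) := by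
    clear * -
    intro P L hP
    induction hP with
    | nil => simp
    | @cons n v P L hn _ ih =>
      have e : val n = v := by simp [val, hn]
      refine ⟨by rw [List.map_cons, List.map_cons, ih.1, e], ?_⟩
      rintro m (_ | ⟨_, hm⟩)
      · rw [hn, e]
      · exact ih.2 m hm
  rw [← (hL' hL).1]
  refine Foam.cocycleInvariant_eq hnd ?_ ?_ ?_
  · rw [hsteps]
    exact (hL' hL).2
  · intro n
    simp only [List.mem_map, mem_initials]
    constructor
    · rintro ⟨_, ⟨c, rfl, hc⟩, rfl⟩
      exact ⟨c, by rw [← packCode_nil, packOnto_eq, List.append_nil], hc⟩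
    · rintro ⟨c, rfl, hc⟩
      exact ⟨_, ⟨c, rfl, hc⟩, by rw [← packCode_nil, packOnto_eq, List.append_nil]⟩
  · intro c h1 h2 h3 l hl
    exact hbd _ ((mem_initials T _).2 ⟨c, rfl, h1, h2, h3⟩) _ (List.mem_map_of_mem hl)

/-! ## The invariant of the foam -/

/-- The values of the colorings of the foam, up to their order. -/
def values52 : List ℕ := List.replicate 60 0 ++ List.replicate 12 1 ++ List.replicate 12 2

/-- The whole enumeration takes place here. The values are compared up to order, since the order of
the search has no meaning. -/
theorem checkDoubleTwist_graph52_true :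
    checkDoubleTwist (graph52 true) (fun L => L.isPerm values52) = true := by
  decide +kernel

theorem checkDoubleTwist_graph52_false :
    checkDoubleTwist (graph52 false) (fun L => L.isPerm values52) = true := by
  decide +kernel

theorem cocycleInvariant_foam52 (e : Bool) :
    (foam52 e).cocycleInvariant =
      Multiset.replicate 60 0 + Multiset.replicate 12 1 + Multiset.replicate 12 2 := by
  have h : checkDoubleTwist (graph52 e) (fun L => L.isPerm values52) = true := by
    cases e
    · exact checkDoubleTwist_graph52_false
    · exact checkDoubleTwist_graph52_true
  obtain ⟨L, hL, hF⟩ := cocycleInvariant_twistSpin_two h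
  refine (hF _).trans ((Multiset.coe_eq_coe.2 ((List.isPerm_iff.1 hL).map _)).trans ?_)
  simp only [values52, List.map_append, List.map_replicate, ← Multiset.coe_add,
    Multiset.coe_replicate, Nat.cast_zero, Nat.cast_one, Nat.cast_ofNat]

end KnottedFoam

theorem mainTheorem1 (e : Bool) :
    (KnottedFoam.foam52 e).cocycleInvariant =
        Multiset.replicate 60 0 + Multiset.replicate 12 1 + Multiset.replicate 12 2 ∧
      ∃ v ∈ (KnottedFoam.foam52 e).cocycleInvariant, v ≠ 0 := by
  refine ⟨KnottedFoam.cocycleInvariant_foam52 e, 1, ?_, by decide⟩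
  rw [KnottedFoam.cocycleInvariant_foam52]
  simp
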